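/- **Model.** A real RAM program is a fixed finite program (sequencing, if-then-else, while loops) acting on index registers holding natural numbers (which can be set, incremented, decremented, compared, and used as addresses) and on a memory of real numbers, on which the only operations are $+,-,\times,/$, comparison, copying, and loading fixed rational constants (no rounding, no roots; $x/0:=0$). Each elementary step, including tests, index operations and control steps, costs one unit. The size of a rational number $p/q$ in lowest terms is $1$ plus the numbers of binary digits of $|p|$ and of $q$, and the size of an instance is the sum of the sizes of its entries. **Theorem.** There exist a single real RAM program and constants $C,c,d\in\mathbb N$ such that the following holds for all integers $m\ge 0$, $n\ge 1$, every matrix $A\in\mathbb Z^{m\times n}$ of full row rank, every $b\in\mathbb Z^m$ and every $u\in\mathbb R^n$ with $u>0$. Started on the input $(A,b,u)$, the program halts after at most $C n^4$ elementary steps (in particular it uses $O(n^4)$ arithmetic operations) and returns one of the following: 1. a point of $P=\{x\in\mathbb R^n : Ax=b,\ x\ge 0\}$; 2. a pair $(v,w)\in\mathbb R^m\times\mathbb R^n$ with $w\ge 0$, $w\ne 0$, such that $$(v^\top A+w^\top)x< v^\top b+\tfrac{1}{2n}\,w^\top u\qquad\text{for every } x\in\mathbb R^n \text{ with } 0\le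 x\le u.$$ Moreover the program is strongly polynomial: if $u$ is rational, then at every moment of the computation every number in the memory is rational and has size at most $c\,N^d$, where $N$ is the size of the instance $(A,b,u)$. -/

import Mathlib

open scoped Matrix

/-! A real RAM: a finite program acts on index registers (natural numbers,
used for addressing and loop control) and on a memory of real numbers arranged in two-dimensional
arrays. Every elementary step has unit cost; the only operations on real numbers are the four
arithmetic operations, comparison, copying and loading a fixed rational constant (in particular
there is no rounding and no root extraction). -/

namespace RealRAM

/-- An index operand: a fixed natural number, or the content of an index register. -/
inductive Ind
  | const (c : ℕ)
  | reg (r : ℕ)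

/-- A reference to the memory cell `(i, j)` of the array with the fixed name `a`. -/
structure Cell where
  arr : ℕ
  row : Ind
  col : Ind

/-- The arithmetic operations. -/
inductive ArithOp
  | add
  | sub
  | mul
  | div

/-- The tests that may guard a branch or a loop. -/
inductive Test
  | lt (x y : Cell)
  | le (x y : Cell)
  | indLt (i j : Ind)
  | indLe (i j : Ind)

/-- Programs. Index registers can only be set, incremented and decremented, so that their contents
never exceed the sum of the running time, of the input dimensions and of a constant depending
only on the program. -/
inductive Prog
  | skip
  | load (dst : Cell) (q : ℚ)
  | copy (dst src : Cell)
  | arith (op : ArithOp) (dst x y : Cell)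
  | indSet (r : ℕ) (i : Ind)
  | indInc (r : ℕ)
  | indDec (r : ℕ)
  | seq (p q : Prog)
  | ite (t : Test) (p q : Prog)
  | while (t : Test) (p : Prog)

/-- The contents of the index registers and of the real memory. -/
structure State where
  ind : ℕ → ℕ
  mem : ℕ → ℕ → ℕ → ℝ

/-- The value of an index operand. -/
def Ind.val (s : State) : Ind → ℕ
  | const c => c
  | reg r => s.ind r

/-- The number stored in a memory cell. -/
def Cell.val (s : State) (x : Cell) : ℝ :=
  s.mem x.arr (x.row.val s) (x.col.val s)

/-- Write the real number `y` into a memory cell. -/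
def State.write (s : State) (x : Cell) (y : ℝ) : State where
  ind := s.ind
  mem := Function.update s.mem x.arr
    (Function.update (s.mem x.arr) (x.row.val s)
      (Function.update (s.mem x.arr (x.row.val s)) (x.col.val s) y))

/-- Write the natural number `k` into an index register. -/
def State.writeInd (s : State) (r k : ℕ) : State where
  ind := Function.update s.ind r k
  mem := s.mem

/-- The arithmetic operations on real numbers (division by zero yields zero). -/
noncomputable def ArithOp.eval : ArithOp → ℝ → ℝ → ℝ
  | add, x, y => x + y
  | sub, x, y => x - y
  | mul, x, y => x * y
  | div, x, y => x / y

/-- Whether a test succeeds. -/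
def Test.Holds (s : State) : Test → Prop
  | lt x y => x.val s < y.val s
  | le x y => x.val s ≤ y.val s
  | indLt i j => i.val s < j.val s
  | indLe i j => i.val s ≤ j.val s

/-- A configuration: the list of programs still to be executed, and the current state.
The machine has halted when the list is empty. -/
structure Config where
  todo : List Prog
  state : State

open Classical in
/-- One elementary step of the machine. -/
noncomputable def Config.step : Config → Config
  | ⟨[], s⟩ => ⟨[], s⟩
  | ⟨.skip :: k, s⟩ => ⟨k, s⟩
  | ⟨.load dst q :: k, s⟩ => ⟨k, s.write dst (q : ℝ)⟩
  | ⟨.copy dst src :: k, s⟩ => ⟨k, s.write dst (src.val s)⟩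
  | ⟨.arith op dst x y :: k, s⟩ => ⟨k, s.write dst (op.eval (x.val s) (y.val s))⟩
  | ⟨.indSet r i :: k, s⟩ => ⟨k, s.writeInd r (i.val s)⟩
  | ⟨.indInc r :: k, s⟩ => ⟨k, s.writeInd r (s.ind r + 1)⟩
  | ⟨.indDec r :: k, s⟩ => ⟨k, s.writeInd r (s.ind r - 1)⟩
  | ⟨.seq p q :: k, s⟩ => ⟨p :: q :: k, s⟩
  | ⟨.ite t p q :: k, s⟩ => if t.Holds s then ⟨p :: k, s⟩ else ⟨q :: k, s⟩
  | ⟨.while t p :: k, s⟩ => if t.Holds s then ⟨p :: .while t p :: k, s⟩ else ⟨k, s⟩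

/-- The configuration after `t` elementary steps of the program `p` started in state `s`. -/
noncomputable def Prog.run (p : Prog) (s : State) (t : ℕ) : Config :=
  Config.step^[t] ⟨[p], s⟩

end RealRAM

/-- The encoding size of a rational number: a sign bit, and the number of binary digits of the
numerator and of the denominator in lowest terms. -/
def ratSize (q : ℚ) : ℕ := 1 + Nat.size q.num.natAbs + Nat.size q.den

namespace LPFeas

/-- The encoding size of an instance `(A, b, u)` with rational `u`. -/
def inputSize {m n : ℕ} (A : Matrix (Fin m) (Fin n) ℤ) (b : Fin m → ℤ) (u : Fin n → ℚ) : ℕ :=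
  (∑ i, ∑ j, ratSize (A i j : ℚ)) + (∑ i, ratSize (b i : ℚ)) + ∑ j, ratSize (u j)

/-- The initial state for the instance `(A, b, u)`: index registers `0` and `1` hold `m` and `n`;
array `0` holds `A`, column `0` of array `1` holds `b`, column `0` of array `2` holds `u`;
everything else is zero. -/
noncomputable def inputState {m n : ℕ} (A : Matrix (Fin m) (Fin n) ℤ) (b : Fin m → ℤ)
    (u : Fin n → ℝ) : RealRAM.State where
  ind := fun r => if r = 0 then m else if r = 1 then n else 0
  mem := fun a i j =>
    if a = 0 then (if h : i < m ∧ j < n then (A ⟨i, h.1⟩ ⟨j, h.2⟩ : ℝ) else 0)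
    else if a = 1 then (if h : i < m ∧ j = 0 then (b ⟨i, h.1⟩ : ℝ) else 0)
    else if a = 2 then (if h : i < n ∧ j = 0 then u ⟨i, h.1⟩ else 0)
    else 0

/-- What the algorithm returns: a vector `x`, or a pair `(v, w)`. -/
inductive Output (m n : ℕ)
  | point (x : Fin n → ℝ)
  | certificate (v : Fin m → ℝ) (w : Fin n → ℝ)

/-- Read the output from a final state: index register `0` tells which kind of output is returned
(`0` for a point); `x`, or else `v` and `w`, stand in column `0` of arrays `0` and `1`. -/
noncomputable def readOutput (m n : ℕ) (s : RealRAM.State) : Output m n :=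
  if s.ind 0 = 0 then .point (fun j => s.mem 0 j 0)
  else .certificate (fun i => s.mem 0 i 0) (fun j => s.mem 1 j 0)

/-- The output is a feasible solution of `A x = b`, `x ≥ 0`, or a pair `(v, w)` with `w ≥ 0`,
`w ≠ 0` and `(vᵀ A + wᵀ) x < vᵀ b + (1 / (2 n)) wᵀ u` for all `x` with `0 ≤ x ≤ u`. -/
def Output.Correct {m n : ℕ} (A : Matrix (Fin m) (Fin n) ℤ) (b : Fin m → ℤ) (u : Fin n → ℝ) :
    Output m n → Prop
  | .point x =>
      A.map (Int.cast : ℤ → ℝ) *ᵥ x = (fun i => (b i : ℝ)) ∧ 0 ≤ x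
  | .certificate v w =>
      0 ≤ w ∧ w ≠ 0 ∧
        ∀ x : Fin n → ℝ, 0 ≤ x → x ≤ u →
          (v ᵥ* A.map (Int.cast : ℤ → ℝ) + w) ⬝ᵥ x
            < v ⬝ᵥ (fun i => (b i : ℝ)) + 1 / (2 * (n : ℝ)) * (w ⬝ᵥ u)

end LPFeas

/-! Put `N = n + 1` and let `M = [A diag(u) | -b]` be the homogenized, rescaled system. A positive
vector `z` in the kernel of `M` gives the point `x j = u j * z j / z n` of the polyhedron. Let `P`
be the orthogonal projection onto `ker M`, and write `P - I = Mᵀ V`.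

The perceptron method keeps a vector `y` of natural numbers, initially zero, together with `z = P
y`. If some `z r ≤ 0`, it adds the unit vector `e r` to `y`. The squared length of `z` then grows by
`2 z r + P r r ≤ 1` (`IsProjTable.sum_sq_tableMul_update`). So after `K = 16 N ^ 3` rounds, either a
positive `z` has been found, or `y` has sum `K` while `‖z‖² ≤ K`. In the second case, Cauchy-Schwarz
bounds the sum of the positive parts of `z` by `√(N K) = 4 N ^ 2`, whereas `K / (2 n) ≥ 8 N ^ 2`.
With `v = V y` and `w j = (y j + δ j) / u j`, where `δ` is the unit vector at `0`, this gap is the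
required strict inequality (`HoldsCertificate.correct`).

`P` and `V` are computed together by `m` rank-one updates (`IsProjTable.succ`), in `O(n ^ 3)` steps.
Each of the `O(n ^ 3)` rounds takes `O(n)` steps, because `P y` and `V y` are maintained by adding a
column of the table.

Numbers stay small because the table after `i` updates depends only on the first `i` rows of `M`:
`V` solves a Gram system, so Cramer's rule bounds its entries independently of the history
(`hasSize_projTable`). In the perceptron phase the table is multiplied only by natural numbers up to
`K`.

The machine part is a program logic `Wp` that bounds the running time and carries a predicate `G` on
all stored numbers. It is used with `G` a size bound for rational `u`, and with `G` trivial
otherwise. -/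

namespace RealRAM

/-! ### A program logic with running times -/

/-- Every number in the memory satisfies `G`. -/
def State.Good (G : ℝ → Prop) (s : State) : Prop := ∀ a i j, G (s.mem a i j)

@[simp] theorem State.write_ind (s : State) (x : Cell) (y : ℝ) : (s.write x y).ind = s.ind := rfl

@[simp] theorem State.writeInd_mem (s : State) (r k : ℕ) : (s.writeInd r k).mem = s.mem := rfl

theorem State.write_mem (s : State) (x : Cell) (y : ℝ) (a i j : ℕ) :
    (s.write x y).mem a i j =
      if a = x.arr ∧ i = x.row.val s ∧ j = x.col.val s then y else s.mem a i j := by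
  unfold State.write
  by_cases h1 : a = x.arr
  · subst h1
    by_cases h2 : i = x.row.val s
    · subst h2
      by_cases h3 : j = x.col.val s
      · subst h3; simp
      · simp [h3]
    · simp [h2]
  · simp [h1]

theorem State.write_mem_of_ne (s : State) (x : Cell) (y : ℝ) (a : ℕ) (h : a ≠ x.arr) :
    (s.write x y).mem a = s.mem a := by
  simp [State.write, h]

theorem State.writeInd_ind (s : State) (r k q : ℕ) :
    (s.writeInd r k).ind q = if q = r then k else s.ind q := by
  simp [State.writeInd, Function.update_apply]

theorem State.Good.write {G : ℝ → Prop} {s : State} (h : s.Good G) (x : Cell) {y : ℝ} (hy : G y) :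
    (s.write x y).Good G := by
  intro a i j
  rw [State.write_mem]
  split_ifs
  · exact hy
  · exact h a i j

/-- The machine moves from `c` to `c'` in `t` steps, all memories on the way being good. -/
def Reach (G : ℝ → Prop) (t : ℕ) (c c' : Config) : Prop :=
  Config.step^[t] c = c' ∧ ∀ k ≤ t, (Config.step^[k] c).state.Good G

theorem Reach.refl {G : ℝ → Prop} {c : Config} (h : c.state.Good G) : Reach G 0 c c :=
  ⟨rfl, fun k hk => by obtain rfl := Nat.le_zero.1 hk; exact h⟩

theorem Reach.single {G : ℝ → Prop} {c c' : Config} (hc : c.state.Good G) (h : c.step = c')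
    (h' : c'.state.Good G) : Reach G 1 c c' := by
  refine ⟨h, fun k hk => ?_⟩
  interval_cases k
  · exact hc
  · simpa [h] using h'

theorem Reach.trans {G : ℝ → Prop} {t t' : ℕ} {c c' c'' : Config} (h : Reach G t c c')
    (h' : Reach G t' c' c'') : Reach G (t + t') c c'' := by
  refine ⟨by rw [add_comm, Function.iterate_add_apply, h.1, h'.1], fun k hk => ?_⟩
  rcases le_total k t with hkt | hkt
  · exact h.2 k hkt
  · obtain ⟨l, rfl⟩ := Nat.exists_eq_add_of_le hkt
    rw [add_comm, Function.iterate_add_apply, h.1]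
    exact h'.2 l (by omega)

theorem Reach.good {G : ℝ → Prop} {t : ℕ} {c c' : Config} (h : Reach G t c c') :
    c'.state.Good G := by
  have := h.2 t le_rfl
  rwa [h.1] at this

/-- Started in `s`, the program `p` halts within `T` steps in a state satisfying `Q`, and all
memories on the way are good if the first one is. -/
def Wp (G : ℝ → Prop) (p : Prog) (T : ℕ) (Q : State → Prop) (s : State) : Prop :=
  s.Good G → ∃ t ≤ T, ∃ s', (∀ k, Reach G t ⟨p :: k, s⟩ ⟨k, s'⟩) ∧ Q s'

variable {G : ℝ → Prop} {p q : Prog} {T T' : ℕ} {Q Q' : State → Prop} {s : State}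

theorem Wp.mono (h : Wp G p T Q s) (hT : T ≤ T') (hQ : ∀ s', s'.Good G → Q s' → Q' s') :
    Wp G p T' Q' s := fun hs => by
  obtain ⟨t, ht, s', hr, hq⟩ := h hs
  exact ⟨t, ht.trans hT, s', hr, hQ _ (hr []).good hq⟩

theorem Wp.atomic {s' : State} (h : ∀ k, Config.step ⟨p :: k, s⟩ = ⟨k, s'⟩)
    (hg : s.Good G → s'.Good G) (hQ : Q s') : Wp G p 1 Q s := fun hs =>
  ⟨1, le_rfl, s', fun k => Reach.single hs (h k) (hg hs), hQ⟩

theorem Wp.skip (hQ : Q s) : Wp G .skip 1 Q s :=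
  Wp.atomic (fun _ => rfl) id hQ

theorem Wp.load {x : Cell} {c : ℚ} (hc : G c) (hQ : Q (s.write x c)) : Wp G (.load x c) 1 Q s :=
  Wp.atomic (fun _ => rfl) (fun h => h.write x hc) hQ

theorem Wp.copy {x y : Cell} (hQ : Q (s.write x (y.val s))) : Wp G (.copy x y) 1 Q s :=
  Wp.atomic (fun _ => rfl) (fun h => h.write x (h _ _ _)) hQ

theorem Wp.arith {op : ArithOp} {x y z : Cell} (hG : G (op.eval (y.val s) (z.val s)))
    (hQ : Q (s.write x (op.eval (y.val s) (z.val s)))) : Wp G (.arith op x y z) 1 Q s :=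
  Wp.atomic (fun _ => rfl) (fun h => h.write x hG) hQ

theorem Wp.indSet {r : ℕ} {i : Ind} (hQ : Q (s.writeInd r (i.val s))) :
    Wp G (.indSet r i) 1 Q s :=
  Wp.atomic (fun _ => rfl) (fun h => h) hQ

theorem Wp.indInc {r : ℕ} (hQ : Q (s.writeInd r (s.ind r + 1))) : Wp G (.indInc r) 1 Q s :=
  Wp.atomic (fun _ => rfl) (fun h => h) hQ

/-- `Wp` quantifies over the list of pending programs, so the run of `p` can be used with `q` still
waiting. The extra unit pays for unfolding the sequence. -/
theorem Wp.seq (h : Wp G p T (Wp G q T' Q) s) : Wp G (.seq p q) (T + T' + 1) Q s := fun hs => by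
  obtain ⟨t, ht, s', hr, hq⟩ := h hs
  obtain ⟨t', ht', s'', hr', hq'⟩ := hq (hr []).good
  refine ⟨1 + t + t', by omega, s'', fun k => ?_, hq'⟩
  exact ((Reach.single hs rfl hs).trans (hr _)).trans (hr' k)

theorem Wp.load_seq {x : Cell} {c : ℚ} (hc : G c) (h : Wp G p T Q (s.write x c)) :
    Wp G (.seq (.load x c) p) (T + 2) Q s :=
  (Wp.seq (T := 1) (Wp.load hc h)).mono (by omega) fun _ _ h => h

theorem Wp.copy_seq {x y : Cell} (h : Wp G p T Q (s.write x (y.val s))) :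
    Wp G (.seq (.copy x y) p) (T + 2) Q s :=
  (Wp.seq (T := 1) (Wp.copy h)).mono (by omega) fun _ _ h => h

theorem Wp.arith_seq {op : ArithOp} {x y z : Cell} (hG : G (op.eval (y.val s) (z.val s)))
    (h : Wp G p T Q (s.write x (op.eval (y.val s) (z.val s)))) :
    Wp G (.seq (.arith op x y z) p) (T + 2) Q s :=
  (Wp.seq (T := 1) (Wp.arith hG h)).mono (by omega) fun _ _ h => h

theorem Wp.indSet_seq {r : ℕ} {i : Ind} (h : Wp G p T Q (s.writeInd r (i.val s))) :
    Wp G (.seq (.indSet r i) p) (T + 2) Q s :=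
  (Wp.seq (T := 1) (Wp.indSet h)).mono (by omega) fun _ _ h => h

theorem Wp.indInc_seq {r : ℕ} (h : Wp G p T Q (s.writeInd r (s.ind r + 1))) :
    Wp G (.seq (.indInc r) p) (T + 2) Q s :=
  (Wp.seq (T := 1) (Wp.indInc h)).mono (by omega) fun _ _ h => h

theorem Wp.ite {b : Test} (h : b.Holds s → Wp G p T Q s) (h' : ¬ b.Holds s → Wp G q T Q s) :
    Wp G (.ite b p q) (T + 1) Q s := fun hs => by
  by_cases hb : b.Holds s
  · obtain ⟨t, ht, s', hr, hq⟩ := h hb hs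
    refine ⟨1 + t, by omega, s', fun k => (Reach.single hs ?_ hs).trans (hr k), hq⟩
    simp [Config.step, hb]
  · obtain ⟨t, ht, s', hr, hq⟩ := h' hb hs
    refine ⟨1 + t, by omega, s', fun k => (Reach.single hs ?_ hs).trans (hr k), hq⟩
    simp [Config.step, hb]

/-- The number of rounds is prescribed, and the indexed invariant decides the guard at every index.
Termination and cost therefore need no separate variant. The final unit is the failing test. -/
theorem Wp.while {b : Test} {n : ℕ} (Inv : ℕ → State → Prop)
    (h0 : Inv 0 s)
    (hstep : ∀ i < n, ∀ s, Inv i s → b.Holds s ∧ Wp G p T (Inv (i + 1)) s)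
    (hend : ∀ s, Inv n s → ¬ b.Holds s ∧ Q s) :
    Wp G (.while b p) (n * (T + 1) + 1) Q s := by
  suffices H : ∀ l i, i + l = n → ∀ s, Inv i s → Wp G (.while b p) (l * (T + 1) + 1) Q s from
    H n 0 (by omega) s h0
  intro l
  induction l with
  | zero =>
    intro i hi s hs hg
    obtain rfl : i = n := by omega
    refine ⟨1, by omega, s, fun k => Reach.single hg ?_ hg, (hend s hs).2⟩
    simp [Config.step, (hend s hs).1]
  | succ l ih =>
    intro i hi s hs hg
    obtain ⟨hb, hw⟩ := hstep i (by omega) s hs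
    obtain ⟨t, ht, s', hr, hq⟩ := hw hg
    obtain ⟨t', ht', s'', hr', hq'⟩ := ih (i + 1) (by omega) s' hq (hr []).good
    refine ⟨1 + t + t', by linarith, s'', fun k => ?_, hq'⟩
    refine ((Reach.single hg ?_ hg).trans (hr _)).trans (hr' k)
    simp [Config.step, hb]

/-! ### The frame rule -/

/-- The program never writes to the array `a`. -/
def Prog.KeepsArr (a : ℕ) : Prog → Prop
  | .load dst _ => a ≠ dst.arr
  | .copy dst _ => a ≠ dst.arr
  | .arith _ dst _ _ => a ≠ dst.arr
  | .seq p q => p.KeepsArr a ∧ q.KeepsArr a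
  | .ite _ p q => p.KeepsArr a ∧ q.KeepsArr a
  | .while _ p => p.KeepsArr a
  | _ => True

/-- The program never writes to the index register `r`. -/
def Prog.KeepsReg (r : ℕ) : Prog → Prop
  | .indSet q _ => r ≠ q
  | .indInc q => r ≠ q
  | .indDec q => r ≠ q
  | .seq p q => p.KeepsReg r ∧ q.KeepsReg r
  | .ite _ p q => p.KeepsReg r ∧ q.KeepsReg r
  | .while _ p => p.KeepsReg r
  | _ => True

/-- The hypothesis concerns the whole list of pending programs, because a step may replace the head
by its parts. In this form it is preserved and can be iterated. -/
theorem Config.step_keepsArr {a : ℕ} (c : Config) (h : ∀ p ∈ c.todo, p.KeepsArr a) :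
    (∀ p ∈ c.step.todo, p.KeepsArr a) ∧ c.step.state.mem a = c.state.mem a := by
  rcases c with ⟨_ | ⟨p, k⟩, s⟩
  · exact ⟨h, rfl⟩
  · rcases p with _ | _ | _ | _ | _ | _ | _ | _ | _ | _ <;>
      simp only [List.mem_cons, forall_eq_or_imp, Prog.KeepsArr] at h <;>
      simp only [Config.step]
    all_goals first
      | exact ⟨h.2, s.write_mem_of_ne _ _ _ h.1⟩
      | (split_ifs <;> simp [h.1.1, h.1.2] <;> exact h.2)
      | (split_ifs <;> simp [h.1, Prog.KeepsArr] <;> exact h.2)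
      | (simp [h.1]; exact h.2)

theorem Config.step_keepsReg {r : ℕ} (c : Config) (h : ∀ p ∈ c.todo, p.KeepsReg r) :
    (∀ p ∈ c.step.todo, p.KeepsReg r) ∧ c.step.state.ind r = c.state.ind r := by
  rcases c with ⟨_ | ⟨p, k⟩, s⟩
  · exact ⟨h, rfl⟩
  · rcases p with _ | _ | _ | _ | _ | _ | _ | _ | _ | _ <;>
      simp only [List.mem_cons, forall_eq_or_imp, Prog.KeepsReg] at h <;>
      simp only [Config.step]
    all_goals first
      | (split_ifs <;> simp [h.1.1, h.1.2] <;> exact h.2)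
      | (split_ifs <;> simp [h.1, Prog.KeepsReg] <;> exact h.2)
      | (simp [h.1, State.writeInd_ind]; exact h.2)

theorem Config.iterate_step_keepsArr {a : ℕ} (t : ℕ) (c : Config)
    (h : ∀ p ∈ c.todo, p.KeepsArr a) : (Config.step^[t] c).state.mem a = c.state.mem a := by
  induction t generalizing c with
  | zero => rfl
  | succ t ih => rw [Function.iterate_succ_apply, ih _ (step_keepsArr c h).1, (step_keepsArr c h).2]

theorem Config.iterate_step_keepsReg {r : ℕ} (t : ℕ) (c : Config)
    (h : ∀ p ∈ c.todo, p.KeepsReg r) : (Config.step^[t] c).state.ind r = c.state.ind r := by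
  induction t generalizing c with
  | zero => rfl
  | succ t ih => rw [Function.iterate_succ_apply, ih _ (step_keepsReg c h).1, (step_keepsReg c h).2]

/-- The states `s` and `s'` agree on whatever `p` does not write to. -/
structure Frame (p : Prog) (s s' : State) : Prop where
  mem : ∀ a, p.KeepsArr a → s'.mem a = s.mem a
  ind : ∀ r, p.KeepsReg r → s'.ind r = s.ind r

theorem Frame.refl (p : Prog) (s : State) : Frame p s s := ⟨fun _ _ => rfl, fun _ _ => rfl⟩

theorem Frame.trans {s' s'' : State} (h : Frame p s s') (h' : Frame p s' s'') : Frame p s s'' :=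
  ⟨fun a ha => (h'.mem a ha).trans (h.mem a ha), fun r hr => (h'.ind r hr).trans (h.ind r hr)⟩

/-- Whatever `p` does not syntactically write is unchanged, so postconditions need only describe
what `p` computes. Running `p` with nothing pending isolates its own effect. -/
theorem Wp.frame (h : Wp G p T Q s) (hQ : ∀ s', Frame p s s' → Q s' → Q' s') :
    Wp G p T Q' s := fun hs => by
  obtain ⟨t, ht, s', hr, hq⟩ := h hs
  refine ⟨t, ht, s', hr, hQ s' ⟨fun a ha => ?_, fun r hr' => ?_⟩ hq⟩
  · have := Config.iterate_step_keepsArr t ⟨[p], s⟩ (by simpa using ha)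
    rwa [(hr []).1] at this
  · have := Config.iterate_step_keepsReg t ⟨[p], s⟩ (by simpa using hr')
    rwa [(hr []).1] at this

theorem Wp.seq_frame (h : Wp G p T Q s)
    (h' : ∀ s', Frame p s s' → Q s' → Wp G q T' Q' s') :
    Wp G (.seq p q) (T + T' + 1) Q' s :=
  Wp.seq (h.frame h')

/-! ### Counted loops -/

/-- Run `body` with register `r` counting from zero up to the content of register `b`. -/
def Prog.for (r b : ℕ) (body : Prog) : Prog :=
  .seq (.indSet r (.const 0)) (.while (.indLt (.reg r) (.reg b)) (.seq body (.indInc r)))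

@[simp] theorem Prog.keepsArr_for {a r b : ℕ} {body : Prog} :
    (Prog.for r b body).KeepsArr a ↔ body.KeepsArr a := by
  simp [Prog.for, Prog.KeepsArr]

@[simp] theorem Prog.keepsReg_for {q r b : ℕ} {body : Prog} :
    (Prog.for r b body).KeepsReg q ↔ q ≠ r ∧ body.KeepsReg q := by
  simp only [Prog.for, Prog.KeepsReg]; tauto

/-- Per round, the three extra units are the test, the unfolding of the sequence and the increment.
The last three are the outer sequence, the initialization and the failing test. -/
theorem Wp.for {r b n : ℕ} {body : Prog} (Inv : ℕ → State → Prop)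
    (hn : s.ind b = n) (hbr : b ≠ r) (hb : body.KeepsReg b) (hr : body.KeepsReg r)
    (h0 : Inv 0 (s.writeInd r 0))
    (hstep : ∀ i < n, ∀ s', Frame (.for r b body) s s' → s'.ind r = i → Inv i s' →
      Wp G body T (fun s'' => Inv (i + 1) (s''.writeInd r (i + 1))) s')
    (hQ : ∀ s', Frame (.for r b body) s s' → Inv n s' → Q s') :
    Wp G (.for r b body) (n * (T + 3) + 3) Q s := by
  have hQ' : ∀ s', Frame (.for r b body) s s' → (Inv n s' ∧ s'.ind r = n) → Q s' :=
    fun s' hf h => hQ s' hf h.1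
  refine Wp.frame (Q := fun s' => Frame (.for r b body) s s' ∧ Inv n s') ?_
    (fun s' hf h => hQ s' hf h.2)
  have key := Wp.while (G := G) (s := s.writeInd r 0) (b := .indLt (.reg r) (.reg b))
    (p := .seq body (.indInc r)) (n := n) (T := T + 1 + 1)
    (Q := fun s' => Frame (.for r b body) s s' ∧ Inv n s')
    (fun i s' => Frame (.for r b body) s s' ∧ s'.ind r = i ∧ Inv i s') ?_ ?_ ?_
  · refine Wp.mono (Wp.seq (T := 1) (Wp.indSet key)) ?_ (fun _ _ h => h)
    nlinarith
  · refine ⟨⟨fun _ _ => rfl, fun q hq => ?_⟩, by simp [State.writeInd_ind], h0⟩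
    rw [Prog.keepsReg_for] at hq
    simp [State.writeInd_ind, hq.1]
  · rintro i hi s' ⟨hf, hir, hI⟩
    have hbn : s'.ind b = n := by rw [hf.ind b (by simp [hbr, hb]), hn]
    refine ⟨by simpa [Test.Holds, Ind.val, hir, hbn] using hi, Wp.seq ?_⟩
    refine (hstep i hi s' hf hir hI).frame fun s'' hf' h => Wp.indInc ?_
    have hr'' : s''.ind r = i := by rw [hf'.ind r hr, hir]
    rw [hr'']
    refine ⟨⟨fun a ha => ?_, fun q hq => ?_⟩, by simp [State.writeInd_ind], h⟩
    · rw [State.writeInd_mem, hf'.mem a (by simpa using ha), hf.mem a ha]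
    · have hq' := Prog.keepsReg_for.1 hq
      rw [State.writeInd_ind, if_neg hq'.1, hf'.ind q hq'.2, hf.ind q hq]
  · rintro s' ⟨hf, hir, hI⟩
    have hbn : s'.ind b = n := by rw [hf.ind b (by simp [hbr, hb]), hn]
    exact ⟨by simp [Test.Holds, Ind.val, hir, hbn], hf, hI⟩

end RealRAM

open Finset

namespace LPFeas

/-! ### Orthogonal projection by rank-one updates -/

/-- Coefficients of the rank-one update that takes the row `M i` into account. -/
def pivotCol (M : ℕ → ℕ → ℝ) (N : ℕ) (S : ℕ → ℕ → ℝ) (i k : ℕ) : ℝ :=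
  ∑ j ∈ range N, S k j * M i j + if k = N + i then 1 else 0

/-- The squared length of the projection of the row `M i`. -/
def pivotNorm (M : ℕ → ℕ → ℝ) (N : ℕ) (S : ℕ → ℕ → ℝ) (i : ℕ) : ℝ :=
  ∑ j ∈ range N, pivotCol M N S i j * pivotCol M N S i j

/-- The first `N` rows form the orthogonal projection onto the kernel of the first `i` rows of `M`;
the rows from `N` on express the difference to the identity as a combination of rows of `M`. -/
noncomputable def projTable (M : ℕ → ℕ → ℝ) (N : ℕ) : ℕ → ℕ → ℕ → ℝ
  | 0 => fun k j => if k = j then 1 else 0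
  | i + 1 => fun k j => projTable M N i k j -
      pivotCol M N (projTable M N i) i k * pivotCol M N (projTable M N i) i j /
        pivotNorm M N (projTable M N i) i

/-- With `P` the first `N` rows and `V` the rest, these are `P = Pᵀ`, `P Mᵀ = 0` and `Mᵀ V = P - I`
for the first `i` rows of `M`. Idempotence follows from them. The vanishing of the later rows of `V`
makes the coefficient of the next row of `M` exactly `1`. -/
structure IsProjTable (M : ℕ → ℕ → ℝ) (N i : ℕ) (S : ℕ → ℕ → ℝ) : Prop where
  symm : ∀ j < N, ∀ l < N, S j l = S l j
  ann : ∀ k < i, ∀ l < N, ∑ j ∈ range N, S l j * M k j = 0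
  comb : ∀ j < N, ∀ l < N,
    ∑ k ∈ range i, M k j * S (N + k) l = S j l - if j = l then 1 else 0
  zero : ∀ k, i ≤ k → ∀ l < N, S (N + k) l = 0

/-- `P P = P (I + Mᵀ V) = P`, since `P Mᵀ = 0`. -/
theorem IsProjTable.mul_self {M S : ℕ → ℕ → ℝ} {N i : ℕ} (h : IsProjTable M N i S) {j l : ℕ}
    (hj : j < N) (hl : l < N) : ∑ k ∈ range N, S j k * S k l = S j l := by
  have : ∀ k ∈ range N, S j k * S k l =
      S j k * (if k = l then 1 else 0) + ∑ a ∈ range i, S j k * M a k * S (N + a) l := by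
    intro k hk
    simp_rw [mul_assoc, ← mul_sum, h.comb k (mem_range.1 hk) l hl]
    ring
  rw [sum_congr rfl this, sum_add_distrib, sum_comm]
  simp_rw [← sum_mul]
  rw [sum_eq_zero (s := range i) fun a ha => by rw [h.ann a (mem_range.1 ha) j hj, zero_mul]]
  simp [hl]

theorem isProjTable_zero (M : ℕ → ℕ → ℝ) (N : ℕ) :
    IsProjTable M N 0 (projTable M N 0) where
  symm j _ l _ := by simp [projTable, eq_comm]
  ann k hk := by omega
  comb j _ l _ := by simp [projTable]
  zero k _ l hl := by simp [projTable]; omega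

/-- The first part of the pivot column is the projection `p` of the new row. It is orthogonal to the
earlier rows, and its inner product with the new row is `‖p‖²` because `P` is symmetric and
idempotent. -/
theorem IsProjTable.sum_mul_pivotCol {M S : ℕ → ℕ → ℝ} {N i : ℕ} (h : IsProjTable M N i S)
    (k : ℕ) (hk : k ≤ i) : ∑ j ∈ range N, M k j * pivotCol M N S i j =
      if k = i then pivotNorm M N S i else 0 := by
  have hcol : ∀ j < N, pivotCol M N S i j = ∑ l ∈ range N, S j l * M i l := by
    intro j hj
    simp [pivotCol, show j ≠ N + i by omega]
  rcases hk.lt_or_eq with hk | rfl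
  · rw [if_neg hk.ne, sum_congr rfl fun j hj => by rw [hcol j (mem_range.1 hj), mul_sum], sum_comm]
    refine sum_eq_zero fun l hl => ?_
    have := h.ann k hk l (mem_range.1 hl)
    calc _ = (∑ j ∈ range N, S l j * M k j) * M i l := by
          rw [sum_mul]
          refine sum_congr rfl fun j hj => ?_
          rw [h.symm l (mem_range.1 hl) j (mem_range.1 hj)]; ring
      _ = 0 := by rw [this, zero_mul]
  · rw [if_pos rfl, pivotNorm]
    symm
    calc _ = ∑ j ∈ range N, ∑ l ∈ range N, S l j * M k l * pivotCol M N S k j := by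
          refine sum_congr rfl fun j hj => ?_
          rw [← sum_mul]
          congr 1
          rw [hcol j (mem_range.1 hj)]
          exact sum_congr rfl fun l hl => by
            rw [h.symm l (mem_range.1 hl) j (mem_range.1 hj)]
      _ = ∑ l ∈ range N, M k l * ∑ j ∈ range N, ∑ a ∈ range N, S l j * S j a * M k a := by
          rw [sum_comm]
          refine sum_congr rfl fun l hl => ?_
          rw [mul_sum]
          refine sum_congr rfl fun j hj => ?_
          rw [hcol j (mem_range.1 hj), mul_sum, mul_sum]
          exact sum_congr rfl fun a ha => by ring
      _ = _ := by
          refine sum_congr rfl fun l hl => ?_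
          congr 1
          rw [sum_comm, hcol l (mem_range.1 hl)]
          refine sum_congr rfl fun a ha => ?_
          rw [← sum_mul, h.mul_self (mem_range.1 hl) (mem_range.1 ha)]

/-- The second part of the pivot column lists the coefficients that express `p` by rows of `M`: the
new row itself, with coefficient `1`, corrected by the earlier rows through `V`. -/
theorem IsProjTable.sum_comb_pivotCol {M S : ℕ → ℕ → ℝ} {N i : ℕ} (h : IsProjTable M N i S)
    (j : ℕ) (hj : j < N) :
    ∑ k ∈ range (i + 1), M k j * pivotCol M N S i (N + k) = pivotCol M N S i j := by
  have h1 : pivotCol M N S i (N + i) = 1 := by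
    rw [pivotCol, if_pos rfl, sum_eq_zero, zero_add]
    intro l hl
    rw [h.zero i le_rfl l (mem_range.1 hl), zero_mul]
  rw [sum_range_succ, h1, mul_one]
  have h2 : ∀ k ∈ range i, M k j * pivotCol M N S i (N + k) =
      ∑ l ∈ range N, M k j * S (N + k) l * M i l := by
    intro k hk
    have hk := mem_range.1 hk
    rw [pivotCol, if_neg (by omega), add_zero, mul_sum]
    exact sum_congr rfl fun l _ => by ring
  rw [sum_congr rfl h2, sum_comm]
  simp_rw [← sum_mul]
  rw [sum_congr rfl fun l hl => by rw [h.comb j hj l (mem_range.1 hl)]]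
  simp [pivotCol, sub_mul, hj, show j ≠ N + i by omega]

/-- This is a Gram-Schmidt step: `P` loses the direction `p`, and `V` is updated by the same
rank-one formula, so that `Mᵀ V = P - I` persists. -/
theorem IsProjTable.succ {M S : ℕ → ℕ → ℝ} {N i : ℕ} (h : IsProjTable M N i S) :
    IsProjTable M N (i + 1) fun k j => S k j -
      pivotCol M N S i k * pivotCol M N S i j / pivotNorm M N S i where
  symm j hj l hl := by rw [h.symm j hj l hl, mul_comm (pivotCol M N S i j)]
  ann k hk l hl := by
    have h1 := h.sum_mul_pivotCol k (by omega)
    have h2 : ∑ j ∈ range N, (S l j - pivotCol M N S i l * pivotCol M N S i j /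
        pivotNorm M N S i) * M k j = ∑ j ∈ range N, S l j * M k j -
        pivotCol M N S i l / pivotNorm M N S i * ∑ j ∈ range N, M k j * pivotCol M N S i j := by
      rw [mul_sum, ← sum_sub_distrib]
      exact sum_congr rfl fun j _ => by ring
    rw [h2, h1]
    by_cases hki : k = i
    · subst hki
      have h3 : ∑ j ∈ range N, S l j * M k j = pivotCol M N S k l := by
        simp [pivotCol, show l ≠ N + k by omega]
      rw [h3, if_pos rfl]
      -- A row depending on its predecessors has `p = 0`. The convention `x / 0 = 0` then leaves the
      -- projection unchanged, as it should, so this step needs no independence.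
      by_cases h0 : pivotNorm M N S k = 0
      · have := (sum_eq_zero_iff_of_nonneg fun j _ =>
          mul_self_nonneg (pivotCol M N S k j)).1 h0 l (mem_range.2 hl)
        rw [mul_self_eq_zero.1 this]; simp
      · field_simp; ring
    · rw [if_neg hki, h.ann k (by omega) l hl]; simp
  comb j hj l hl := by
    simp_rw [mul_sub, sum_sub_distrib]
    have h1 : ∑ k ∈ range (i + 1), M k j * (pivotCol M N S i (N + k) * pivotCol M N S i l /
        pivotNorm M N S i) = pivotCol M N S i j * pivotCol M N S i l / pivotNorm M N S i := by
      rw [← h.sum_comb_pivotCol j hj, sum_mul, sum_div]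
      exact sum_congr rfl fun _ _ => by ring
    rw [h1, sum_range_succ, h.zero i le_rfl l hl, h.comb j hj l hl]
    ring
  zero k hk l hl := by
    have h1 : pivotCol M N S i (N + k) = 0 := by
      rw [pivotCol, if_neg (by omega), add_zero]
      exact sum_eq_zero fun j hj => by rw [h.zero k (by omega) j (mem_range.1 hj), zero_mul]
    rw [h1, h.zero k (by omega) l hl]; simp

theorem isProjTable_projTable (M : ℕ → ℕ → ℝ) (N i : ℕ) :
    IsProjTable M N i (projTable M N i) := by
  induction i with
  | zero => exact isProjTable_zero M N
  | succ i ih => exact ih.succ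

/-! ### The perceptron potential -/

/-- The product of the table `S` with the vector `y`. -/
noncomputable def tableMul (S : ℕ → ℕ → ℝ) (N : ℕ) (y : ℕ → ℕ) (k : ℕ) : ℝ :=
  ∑ j ∈ range N, S k j * y j

theorem tableMul_update (S : ℕ → ℕ → ℝ) (N : ℕ) (y : ℕ → ℕ) (k : ℕ) {r : ℕ} (hr : r < N) :
    tableMul S N (Function.update y r (y r + 1)) k = tableMul S N y k + S k r := by
  have : ∀ j ∈ range N, S k j * (Function.update y r (y r + 1) j : ℕ) =
      S k j * y j + if j = r then S k r else 0 := by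
    intro j _
    by_cases hj : j = r
    · subst hj; simp [mul_add]
    · simp [hj]
  rw [tableMul, sum_congr rfl this, sum_add_distrib]
  simp [hr, tableMul]

theorem sum_update_succ (N : ℕ) (y : ℕ → ℕ) {r : ℕ} (hr : r < N) :
    ∑ j ∈ range N, Function.update y r (y r + 1) j = ∑ j ∈ range N, y j + 1 := by
  have : ∀ j ∈ range N, Function.update y r (y r + 1) j = y j + if j = r then 1 else 0 := by
    intro j _
    by_cases hj : j = r
    · subst hj; simp
    · simp [hj]
  rw [sum_congr rfl this, sum_add_distrib]
  simp [hr]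

/-- Expand `‖z + P e_r‖² = ‖z‖² + 2 ⟨z, P e_r⟩ + ‖P e_r‖²`. As `P` is a projection and `z` is in its
image, the inner product is `z r ≤ 0` and the last term is `P r r ≤ 1`. -/
theorem IsProjTable.sum_sq_tableMul_update {M S : ℕ → ℕ → ℝ} {N i : ℕ} (h : IsProjTable M N i S)
    (y : ℕ → ℕ) {r : ℕ} (hr : r < N) (hz : tableMul S N y r ≤ 0) :
    ∑ j ∈ range N, tableMul S N (Function.update y r (y r + 1)) j ^ 2 ≤
      ∑ j ∈ range N, tableMul S N y j ^ 2 + 1 := by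
  have h1 : ∑ j ∈ range N, tableMul S N y j * S j r = tableMul S N y r := by
    simp_rw [tableMul, sum_mul]
    rw [sum_comm]
    refine sum_congr rfl fun l hl => ?_
    rw [← h.mul_self hr (mem_range.1 hl), sum_mul]
    refine sum_congr rfl fun j hj => ?_
    rw [h.symm r hr j (mem_range.1 hj)]; ring
  have h2 : ∑ j ∈ range N, S j r ^ 2 = S r r := by
    rw [← h.mul_self hr hr]
    refine sum_congr rfl fun j hj => ?_
    rw [h.symm r hr j (mem_range.1 hj)]; ring
  have h3 : S r r ≤ 1 := by
    -- `S r r` is the squared length of column `r`, which contains `S r r` itself.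
    have : S r r ^ 2 ≤ S r r := by
      conv_rhs => rw [← h2]
      exact single_le_sum (f := fun j => S j r ^ 2) (fun _ _ => sq_nonneg _) (mem_range.2 hr)
    nlinarith
  have h4 : ∑ j ∈ range N, tableMul S N (Function.update y r (y r + 1)) j ^ 2 =
      ∑ j ∈ range N, tableMul S N y j ^ 2 + 2 * ∑ j ∈ range N, tableMul S N y j * S j r +
        ∑ j ∈ range N, S j r ^ 2 := by
    rw [mul_sum, ← sum_add_distrib, ← sum_add_distrib]
    refine sum_congr rfl fun j _ => ?_
    rw [tableMul_update _ _ _ _ hr]; ring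
  rw [h4, h1, h2]
  linarith

/-- This makes a positive `z = P y` a solution of the homogeneous system. -/
theorem IsProjTable.sum_mul_tableMul {M S : ℕ → ℕ → ℝ} {N i : ℕ} (h : IsProjTable M N i S)
    (y : ℕ → ℕ) {k : ℕ} (hk : k < i) : ∑ j ∈ range N, M k j * tableMul S N y j = 0 := by
  simp_rw [tableMul, mul_sum]
  rw [sum_comm]
  refine sum_eq_zero fun l hl => ?_
  have := h.ann k hk l (mem_range.1 hl)
  rw [← zero_mul (y l : ℝ), ← this, sum_mul]
  refine sum_congr rfl fun j hj => ?_
  rw [h.symm l (mem_range.1 hl) j (mem_range.1 hj)]; ring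

/-- The identity `Mᵀ (V y) = P y - y` supplies the multipliers `v` of the certificate. -/
theorem IsProjTable.sum_mul_tableMul_add {M S : ℕ → ℕ → ℝ} {N i : ℕ} (h : IsProjTable M N i S)
    (y : ℕ → ℕ) {j : ℕ} (hj : j < N) :
    ∑ k ∈ range i, M k j * tableMul S N y (N + k) = tableMul S N y j - y j := by
  simp_rw [tableMul, mul_sum]
  rw [sum_comm]
  have : ∀ l ∈ range N, ∑ k ∈ range i, M k j * (S (N + k) l * y l) =
      S j l * y l - (if j = l then 1 else 0) * y l := by
    intro l hl
    simp_rw [← mul_assoc, ← sum_mul, h.comb j hj l (mem_range.1 hl), sub_mul]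
  rw [sum_congr rfl this, sum_sub_distrib]
  simp [hj]

/-- Cauchy-Schwarz for the bound on the certificate. -/
theorem sum_max_le_of_sum_sq_le {N : ℕ} {z : ℕ → ℝ} {B : ℝ} (hB : 0 ≤ B)
    (h : N * ∑ j ∈ range N, z j ^ 2 ≤ B ^ 2) : ∑ j ∈ range N, max (z j) 0 ≤ B := by
  refine le_of_sq_le_sq ?_ hB
  refine le_trans ?_ h
  have := sq_sum_le_card_mul_sum_sq (s := range N) (f := fun j => max (z j) 0)
  rw [card_range] at this
  refine this.trans (mul_le_mul_of_nonneg_left (sum_le_sum fun j _ => ?_) (by positivity))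
  rcases le_total (z j) 0 with hz | hz
  · simp [max_eq_right hz, sq_nonneg]
  · simp [max_eq_left hz]

end LPFeas

namespace LPFeas

/-! ### Size calculus for fractions not necessarily in lowest terms -/

/-- The number `x` is a fraction whose numerator and denominator are at most `2 ^ e`. -/
def HasSize (e : ℕ) (x : ℝ) : Prop :=
  ∃ (a : ℤ) (b : ℕ), 0 < b ∧ |a| ≤ 2 ^ e ∧ b ≤ 2 ^ e ∧ x = a / b

theorem HasSize.mono {e f : ℕ} {x : ℝ} (h : HasSize e x) (hef : e ≤ f) : HasSize f x := by
  obtain ⟨a, b, hb, ha, hb', hx⟩ := h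
  exact ⟨a, b, hb, ha.trans (pow_le_pow_right₀ (by norm_num) hef),
    hb'.trans (pow_le_pow_right₀ (by norm_num) hef), hx⟩

theorem hasSize_nat {e k : ℕ} (h : k ≤ 2 ^ e) : HasSize e k :=
  ⟨k, 1, one_pos, by rw [Nat.abs_cast]; exact_mod_cast h, Nat.one_le_two_pow, by simp⟩

theorem hasSize_zero (e : ℕ) : HasSize e 0 := by
  simpa using hasSize_nat (e := e) (k := 0) (Nat.zero_le _)

theorem hasSize_one (e : ℕ) : HasSize e 1 := by
  simpa using hasSize_nat (e := e) (k := 1) Nat.one_le_two_pow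

theorem HasSize.neg {e : ℕ} {x : ℝ} (h : HasSize e x) : HasSize e (-x) := by
  obtain ⟨a, b, hb, ha, hb', rfl⟩ := h
  exact ⟨-a, b, hb, by rwa [abs_neg], hb', by push_cast; ring⟩

theorem HasSize.mul {e f : ℕ} {x y : ℝ} (hx : HasSize e x) (hy : HasSize f y) :
    HasSize (e + f) (x * y) := by
  obtain ⟨a, b, hb, ha, hb', rfl⟩ := hx
  obtain ⟨c, d, hd, hc, hd', rfl⟩ := hy
  refine ⟨a * c, b * d, Nat.mul_pos hb hd, ?_, ?_, by push_cast; rw [div_mul_div_comm]⟩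
  · rw [abs_mul, pow_add]; exact mul_le_mul ha hc (abs_nonneg _) (by positivity)
  · rw [pow_add]; exact Nat.mul_le_mul hb' hd'

theorem HasSize.inv {e : ℕ} {x : ℝ} (hx : HasSize e x) : HasSize e x⁻¹ := by
  obtain ⟨a, b, hb, ha, hb', rfl⟩ := hx
  by_cases h0 : a = 0
  · subst h0; simpa using hasSize_zero e
  · refine ⟨a.sign * b, a.natAbs, Int.natAbs_pos.2 h0, ?_, ?_, ?_⟩
    · rw [abs_mul, Int.abs_sign_of_ne_zero h0, one_mul, Nat.abs_cast]; exact_mod_cast hb'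
    · rw [Int.abs_eq_natAbs] at ha; exact_mod_cast ha
    · have h1 : ((a.natAbs : ℕ) : ℝ) = a.sign * a := by
        rw [Nat.cast_natAbs, ← Int.sign_mul_self_eq_abs]; push_cast; ring
      have h2 : ((a.sign : ℤ) : ℝ) ≠ 0 := by simpa using h0
      have h3 : ((a : ℤ) : ℝ) ≠ 0 := by simpa using h0
      rw [h1, inv_div]
      push_cast
      field_simp

theorem HasSize.div {e f : ℕ} {x y : ℝ} (hx : HasSize e x) (hy : HasSize f y) :
    HasSize (e + f) (x / y) := by
  rw [div_eq_mul_inv]; exact hx.mul hy.inv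

theorem HasSize.add {e f : ℕ} {x y : ℝ} (hx : HasSize e x) (hy : HasSize f y) :
    HasSize (e + f + 1) (x + y) := by
  obtain ⟨a, b, hb, ha, hb', rfl⟩ := hx
  obtain ⟨c, d, hd, hc, hd', rfl⟩ := hy
  have hbR : (b : ℝ) ≠ 0 := by exact_mod_cast hb.ne'
  have hdR : (d : ℝ) ≠ 0 := by exact_mod_cast hd.ne'
  refine ⟨a * d + b * c, b * d, Nat.mul_pos hb hd, ?_, ?_, ?_⟩
  · have h1 : |a * (d : ℤ)| ≤ 2 ^ e * 2 ^ f := by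
      rw [abs_mul, Nat.abs_cast]
      exact mul_le_mul ha (by exact_mod_cast hd') (by positivity) (by positivity)
    have h2 : |(b : ℤ) * c| ≤ 2 ^ e * 2 ^ f := by
      rw [abs_mul, Nat.abs_cast]
      exact mul_le_mul (by exact_mod_cast hb') hc (abs_nonneg _) (by positivity)
    rw [pow_succ, pow_add]
    linarith [abs_add_le (a * (d : ℤ)) (b * c)]
  · calc b * d ≤ 2 ^ e * 2 ^ f := Nat.mul_le_mul hb' hd'
      _ = 2 ^ (e + f) := (pow_add _ _ _).symm
      _ ≤ _ := pow_le_pow_right₀ (by norm_num) (by omega)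
  · push_cast; field_simp

theorem HasSize.sum {ι : Type*} {s : Finset ι} {f : ι → ℝ} {e k : ℕ} (hs : #s ≤ k)
    (h : ∀ i ∈ s, HasSize e (f i)) : HasSize (k * (e + 1)) (∑ i ∈ s, f i) := by
  classical
  refine HasSize.mono ?_ (Nat.mul_le_mul_right _ hs)
  clear hs
  induction s using Finset.induction_on with
  | empty => simpa using hasSize_zero 0
  | insert a s ha ih =>
    rw [sum_insert ha, card_insert_of_notMem ha]
    refine ((h a (by simp)).add (ih fun i hi => h i (by simp [hi]))).mono (le_of_eq ?_)
    ring

/-- Clear all denominators by their product `q ≤ 2 ^ (e * m ^ 2)`. The integer determinant is at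
most `m!` times the `m`-th power of the entry bound, with `m! ≤ 2 ^ (m ^ 2)`, and dividing by `q ^
m` restores the scale. -/
theorem HasSize.det {m e : ℕ} {A : Matrix (Fin m) (Fin m) ℝ} (h : ∀ i j, HasSize e (A i j)) :
    HasSize (m ^ 2 + m * (e + e * m ^ 2)) A.det := by
  choose a b hb ha hb' hA using h
  set q : ℕ := ∏ i, ∏ j, b i j with hq
  have hq0 : 0 < q := prod_pos fun i _ => prod_pos fun j _ => hb i j
  have hq2 : q ≤ 2 ^ (e * m ^ 2) := by
    calc q ≤ ∏ i : Fin m, ∏ j : Fin m, 2 ^ e :=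
          prod_le_prod' fun i _ => prod_le_prod' fun j _ => hb' i j
      _ = _ := by simp; rw [← pow_mul, ← pow_mul]; ring
  have hdvd : ∀ i j, b i j ∣ q := fun i j =>
    (dvd_prod_of_mem (fun j => b i j) (mem_univ j)).trans
      (dvd_prod_of_mem (fun i => ∏ j, b i j) (mem_univ i))
  set Z : Matrix (Fin m) (Fin m) ℤ := Matrix.of fun i j => a i j * (q / b i j : ℕ) with hZ
  have hqR : (q : ℝ) ≠ 0 := by exact_mod_cast hq0.ne'
  have hAZ : A = (q : ℝ)⁻¹ • Z.map (Int.cast : ℤ → ℝ) := by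
    ext i j
    have hbR : (b i j : ℝ) ≠ 0 := by exact_mod_cast (hb i j).ne'
    simp only [hZ, Matrix.smul_apply, Matrix.map_apply, Matrix.of_apply, smul_eq_mul]
    rw [hA i j, Int.cast_mul, Int.cast_natCast, Nat.cast_div (hdvd i j) hbR]
    field_simp
  have hZ2 : ∀ i j, |Z i j| ≤ 2 ^ (e + e * m ^ 2) := by
    intro i j
    simp only [hZ, Matrix.of_apply]
    rw [abs_mul, Nat.abs_cast, pow_add]
    refine mul_le_mul (ha i j) ?_ (by positivity) (by positivity)
    exact_mod_cast (Nat.div_le_self q (b i j)).trans hq2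
  have hdet := Matrix.det_le (A := Z) (abv := AbsoluteValue.abs) hZ2
  refine ⟨Z.det, q ^ m, by positivity, ?_, ?_, ?_⟩
  · refine hdet.trans ?_
    rw [Fintype.card_fin, nsmul_eq_mul, pow_add 2 (m ^ 2), ← pow_mul, mul_comm m (e + e * m ^ 2)]
    refine mul_le_mul_of_nonneg_right ?_ (by positivity)
    have : m.factorial ≤ 2 ^ (m ^ 2) := by
      calc m.factorial ≤ m ^ m := Nat.factorial_le_pow m
        _ ≤ (2 ^ m) ^ m := Nat.pow_le_pow_left Nat.lt_two_pow_self.le m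
        _ = _ := by rw [← pow_mul, sq]
    exact_mod_cast this
  · calc q ^ m ≤ (2 ^ (e * m ^ 2)) ^ m := Nat.pow_le_pow_left hq2 m
      _ = 2 ^ (e * m ^ 2 * m) := (pow_mul _ _ _).symm
      _ ≤ _ := pow_le_pow_right₀ (by norm_num) (by nlinarith [Nat.zero_le (m * e)])
  · rw [hAZ, Matrix.det_smul, Fintype.card_fin]
    have : (Z.map (Int.cast : ℤ → ℝ)).det = (Z.det : ℝ) := by
      have := (Int.castRingHom ℝ).map_det Z
      simpa using this.symm
    rw [this, inv_pow, Nat.cast_pow, div_eq_inv_mul]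

theorem HasSize.matrix_inv {m e : ℕ} {A : Matrix (Fin m) (Fin m) ℝ}
    (h : ∀ i j, HasSize e (A i j)) (i j : Fin m) :
    HasSize (2 * (m ^ 2 + m * (e + e * m ^ 2))) (A⁻¹ i j) := by
  rw [Matrix.inv_def, Matrix.smul_apply, smul_eq_mul, Ring.inverse_eq_inv', two_mul,
    Matrix.adjugate_apply]
  refine (HasSize.det h).inv.mul (HasSize.det fun k l => ?_)
  rw [Matrix.updateRow_apply]
  split_ifs
  · rw [Pi.single_apply]
    split_ifs
    · exact hasSize_one e
    · exact hasSize_zero e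
  · exact h k l

/-- Reduction to lowest terms only shrinks numerator and denominator. A number up to `2 ^ e` has at
most `e + 1` binary digits. -/
theorem HasSize.exists_rat {e : ℕ} {x : ℝ} (h : HasSize e x) :
    ∃ q : ℚ, x = q ∧ ratSize q ≤ 2 * e + 3 := by
  obtain ⟨a, b, hb, ha, hb', rfl⟩ := h
  refine ⟨a / b, by push_cast; rfl, ?_⟩
  have hlt : 2 ^ e < 2 ^ (e + 1) := Nat.pow_lt_pow_right (by norm_num) (Nat.lt_succ_self e)
  have hbZ : (b : ℤ) ≠ 0 := by exact_mod_cast hb.ne'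
  have h1 : ((a : ℚ) / b).num.natAbs ≤ 2 ^ e := by
    rw [Int.abs_eq_natAbs] at ha
    have ha' : a.natAbs ≤ 2 ^ e := by exact_mod_cast ha
    by_cases h0 : a = 0
    · subst h0; simp
    · refine le_trans (Nat.le_of_dvd (Int.natAbs_pos.2 h0) (Int.natAbs_dvd_natAbs.2 ?_)) ha'
      simpa [Rat.mkRat_eq_div] using Rat.num_dvd a hbZ
  have h2 : ((a : ℚ) / b).den ≤ 2 ^ e := by
    refine le_trans (Nat.le_of_dvd hb ?_) hb'
    have := Int.natCast_dvd_natCast.1 (Rat.den_dvd a b)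
    rwa [Rat.divInt_eq_div, Int.cast_natCast] at this
  have h3 := Nat.size_le.2 (h1.trans_lt hlt)
  have h4 := Nat.size_le.2 (h2.trans_lt hlt)
  unfold ratSize
  omega

theorem hasSize_of_ratSize_le {e : ℕ} {q : ℚ} (h : ratSize q ≤ e) : HasSize e q := by
  unfold ratSize at h
  refine ⟨q.num, q.den, q.den_pos, ?_, ?_, ?_⟩
  · rw [Int.abs_eq_natAbs]
    exact_mod_cast (Nat.size_le.1 (show Nat.size q.num.natAbs ≤ e by omega)).le
  · exact (Nat.size_le.1 (show Nat.size q.den ≤ e by omega)).le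
  · exact_mod_cast (Rat.num_div_den q).symm

/-! ### Sizes of the projection table through Gram matrices -/

/-- The first `i` rows of `M`, the others being set to zero. -/
def maskedRows (M : ℕ → ℕ → ℝ) (m N i : ℕ) : Matrix (Fin m) (Fin N) ℝ :=
  Matrix.of fun k j => if (k : ℕ) < i then M k j else 0

/-- The Gram matrix of the first `i` rows of `M`, enlarged by an identity block. -/
def maskedGram (M : ℕ → ℕ → ℝ) (m N i : ℕ) : Matrix (Fin m) (Fin m) ℝ :=
  maskedRows M m N i * (maskedRows M m N i)ᵀ +
    Matrix.diagonal fun k : Fin m => if (k : ℕ) < i then (0 : ℝ) else 1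

/-- The quadratic form is `‖Bᵀ v‖²` plus the squares of the masked coordinates of `v`. If it
vanishes, `v` is a linear relation among the first `i` rows, hence zero. -/
theorem det_maskedGram_ne_zero {M : ℕ → ℕ → ℝ} {m N : ℕ} (i : ℕ)
    (hM : ∀ c : Fin m → ℝ, (∀ j < N, ∑ k, c k * M k j = 0) → c = 0) :
    (maskedGram M m N i).det ≠ 0 := by
  intro h0
  obtain ⟨v, hv, hGv⟩ := Matrix.exists_mulVec_eq_zero_iff.2 h0
  set B := maskedRows M m N i with hB
  set d : Fin m → ℝ := fun k => if (k : ℕ) < i then 0 else 1 with hd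
  have h1 : (Bᵀ *ᵥ v) ⬝ᵥ (Bᵀ *ᵥ v) + ∑ k, d k * v k ^ 2 = 0 := by
    have h2 : v ⬝ᵥ (maskedGram M m N i *ᵥ v) = 0 := by rw [hGv, dotProduct_zero]
    rw [maskedGram, ← hB, Matrix.add_mulVec, dotProduct_add, ← Matrix.mulVec_mulVec,
      Matrix.dotProduct_mulVec, ← Matrix.mulVec_transpose] at h2
    rw [← h2]
    congr 1
    simp only [dotProduct, Matrix.mulVec_diagonal]
    exact sum_congr rfl fun k _ => by ring
  have hd0 : ∀ k, 0 ≤ d k * v k ^ 2 := fun k => by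
    simp only [hd]; split_ifs <;> nlinarith [sq_nonneg (v k)]
  have h3 : 0 ≤ (Bᵀ *ᵥ v) ⬝ᵥ (Bᵀ *ᵥ v) := sum_nonneg fun _ _ => mul_self_nonneg _
  have h4 : 0 ≤ ∑ k, d k * v k ^ 2 := sum_nonneg fun k _ => hd0 k
  have h5 : Bᵀ *ᵥ v = 0 := dotProduct_self_eq_zero.1 (by linarith)
  have h6 := (sum_eq_zero_iff_of_nonneg fun k _ => hd0 k).1 (by linarith : ∑ k, d k * v k ^ 2 = 0)
  refine hv (hM v fun j hj => ?_)
  have h7 := congrFun h5 ⟨j, hj⟩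
  simp only [Matrix.mulVec, dotProduct, Matrix.transpose_apply, hB, maskedRows, Matrix.of_apply,
    Pi.zero_apply] at h7
  rw [← h7]
  refine sum_congr rfl fun k hk => ?_
  by_cases hki : (k : ℕ) < i
  · rw [if_pos hki, mul_comm]
  · have := h6 k hk
    simp only [hd, if_neg hki, one_mul] at this
    rw [pow_eq_zero_iff (by norm_num)] at this
    rw [this, zero_mul, mul_zero]

/-- Multiply `Bᵀ V = P - I` by `B` and use `B P = 0`. On masked rows both sides vanish because those
rows of `V` are still zero. -/
theorem IsProjTable.maskedGram_mul {M S : ℕ → ℕ → ℝ} {m N i : ℕ} (h : IsProjTable M N i S)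
    (hi : i ≤ m) :
    maskedGram M m N i * (Matrix.of fun (k : Fin m) (l : Fin N) => S (N + k) l) =
      -maskedRows M m N i := by
  set V : Matrix (Fin m) (Fin N) ℝ := Matrix.of fun k l => S (N + k) l with hV
  have h1 : (maskedRows M m N i)ᵀ * V =
      Matrix.of fun (j l : Fin N) => S j l - if (j : ℕ) = l then 1 else 0 := by
    ext j l
    rw [Matrix.mul_apply, Matrix.of_apply, ← h.comb j j.2 l l.2]
    simp only [Matrix.transpose_apply, maskedRows, Matrix.of_apply, hV]
    rw [Fin.sum_univ_eq_sum_range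
      (fun k => (if k < i then M k j else 0) * S (N + k) l) m]
    symm
    refine sum_subset_zero_on_sdiff (range_mono hi) ?_ ?_
    · intro k hk
      rw [mem_sdiff, mem_range, mem_range] at hk
      rw [if_neg hk.2, zero_mul]
    · intro k hk
      rw [if_pos (mem_range.1 hk)]
  rw [maskedGram, Matrix.add_mul, Matrix.mul_assoc, h1]
  ext k l
  rw [Matrix.add_apply, Matrix.mul_apply, Matrix.diagonal_mul, Matrix.neg_apply]
  by_cases hk : (k : ℕ) < i
  · simp only [maskedRows, Matrix.of_apply, if_pos hk, zero_mul, add_zero, mul_sub,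
      sum_sub_distrib]
    have h2 := h.ann k hk l l.2
    rw [← Fin.sum_univ_eq_sum_range (fun j => S l j * M k j) N] at h2
    have h3 : ∑ j : Fin N, M k j * S j l = 0 := by
      rw [← h2]
      exact sum_congr rfl fun j _ => by rw [h.symm l l.2 j j.2, mul_comm]
    rw [h3]
    simp [Fin.val_inj]
  · simp [maskedRows, hk, hV, h.zero k (by omega) l l.2]

/-- Solve the Gram system for `V` by Cramer's rule, then recover `P = I + Mᵀ V`. The bound does not
accumulate with `i`. The entries of `M` are allowed `2 * X` since they may be products of two
inputs. -/
theorem hasSize_projTable {M : ℕ → ℕ → ℝ} {m N i X : ℕ} (hX : 1 ≤ X) (hN : N ≤ X) (hm : m ≤ X)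
    (hsize : ∀ k < m, ∀ j < N, HasSize (2 * X) (M k j))
    (hM : ∀ c : Fin m → ℝ, (∀ j < N, ∑ k, c k * M k j = 0) → c = 0) (hi : i ≤ m) {k l : ℕ}
    (hk : k < N + m) (hl : l < N) : HasSize (40 * X ^ 7) (projTable M N i k l) := by
  have hp : ∀ {a b : ℕ}, a ≤ b → X ^ a ≤ X ^ b := fun h => Nat.pow_le_pow_right hX h
  set S := projTable M N i with hS
  have h : IsProjTable M N i S := isProjTable_projTable M N i
  have hB : ∀ k j, HasSize (2 * X) (maskedRows M m N i k j) := by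
    intro k j
    rw [maskedRows, Matrix.of_apply]
    split_ifs
    · exact hsize k k.2 j j.2
    · exact hasSize_zero _
  have hG : ∀ k k', HasSize (6 * X ^ 2) (maskedGram M m N i k k') := by
    intro k k'
    rw [maskedGram, Matrix.add_apply, Matrix.mul_apply]
    have h1 := HasSize.sum (s := (univ : Finset (Fin N))) (k := X) (by simpa using hN)
      fun j _ => (hB k j).mul (hB k' j)
    have h2 : HasSize 0 (Matrix.diagonal (fun k : Fin m => if (k : ℕ) < i then (0 : ℝ) else 1)
        k k') := by
      rw [Matrix.diagonal_apply]
      split_ifs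
      exacts [hasSize_zero _, hasSize_one _, hasSize_zero _]
    refine (h1.add h2).mono ?_
    nlinarith [hp (show 1 ≤ 2 by norm_num), hp (show 0 ≤ 2 by norm_num)]
  have hinv : ∀ k k', HasSize (26 * X ^ 5) ((maskedGram M m N i)⁻¹ k k') := by
    intro k k'
    refine (HasSize.matrix_inv hG k k').mono ?_
    calc 2 * (m ^ 2 + m * (6 * X ^ 2 + 6 * X ^ 2 * m ^ 2))
        ≤ 2 * (X ^ 2 + X * (6 * X ^ 2 + 6 * X ^ 2 * X ^ 2)) := by gcongr
      _ = 2 * X ^ 2 + 12 * X ^ 3 + 12 * X ^ 5 := by ring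
      _ ≤ _ := by linarith [hp (show 2 ≤ 5 by norm_num), hp (show 3 ≤ 5 by norm_num)]
  have hV : ∀ (k : Fin m) (l : Fin N), HasSize (27 * X ^ 6 + 2 * X ^ 2) (S (N + k) l) := by
    intro k l
    have h1 := h.maskedGram_mul hi
    have hu : IsUnit (maskedGram M m N i).det := (det_maskedGram_ne_zero i hM).isUnit
    have h2 : (Matrix.of fun (k : Fin m) (l : Fin N) => S (N + k) l) =
        (maskedGram M m N i)⁻¹ * -maskedRows M m N i := by
      rw [← h1, ← Matrix.mul_assoc, Matrix.nonsing_inv_mul _ hu, Matrix.one_mul]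
    have h3 := congrFun (congrFun h2 k) l
    rw [Matrix.of_apply, Matrix.mul_apply] at h3
    rw [h3]
    refine (HasSize.sum (s := (univ : Finset (Fin m))) (k := X) (by simpa using hm)
      fun j _ => (hinv k j).mul (hB j l).neg).mono ?_
    calc X * (26 * X ^ 5 + 2 * X + 1) = 26 * X ^ 6 + 2 * X ^ 2 + X ^ 1 := by ring
      _ ≤ _ := by linarith [hp (show 1 ≤ 6 by norm_num)]
  by_cases hkN : k < N
  · have h1 := h.comb k hkN l hl
    have h2 : S k l = ∑ a ∈ range i, M a k * S (N + a) l + if k = l then 1 else 0 := by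
      rw [h1]; ring
    have h3 : HasSize 0 (if k = l then (1 : ℝ) else 0) := by
      split_ifs
      exacts [hasSize_one _, hasSize_zero _]
    rw [h2]
    refine ((HasSize.sum (e := 2 * X + (27 * X ^ 6 + 2 * X ^ 2)) (k := X)
      (by simpa using hi.trans hm) fun a ha => ?_).add h3).mono ?_
    · have ha := mem_range.1 ha
      exact (hsize a (by omega) k hkN).mul (hV ⟨a, by omega⟩ ⟨l, hl⟩)
    · linarith [hp (show 0 ≤ 7 by norm_num), hp (show 1 ≤ 7 by norm_num),
        hp (show 2 ≤ 7 by norm_num), hp (show 3 ≤ 7 by norm_num), Nat.zero_le (X ^ 7)]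
  · obtain ⟨a, rfl⟩ := Nat.exists_eq_add_of_le (not_lt.1 hkN)
    refine (hV ⟨a, by omega⟩ ⟨l, hl⟩).mono ?_
    linarith [hp (show 6 ≤ 7 by norm_num), hp (show 2 ≤ 7 by norm_num), Nat.zero_le (X ^ 7)]

end LPFeas

namespace LPFeas
open RealRAM

/-! ### Setting up the system and the initial table -/

/-- The cell of the array `a` that holds a scalar. -/
abbrev scalarCell (a : ℕ) : Cell := ⟨a, .const 0, .const 0⟩

/-- The entry of the vector `a` addressed by the register `r`. -/
abbrev vecCell (a r : ℕ) : Cell := ⟨a, .reg r, .const 0⟩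

/-- The entry of the matrix `a` addressed by the registers `r` and `q`. -/
abbrev matCell (a r q : ℕ) : Cell := ⟨a, .reg r, .reg q⟩

attribute [simp] Cell.val Ind.val State.write_mem State.writeInd_ind ArithOp.eval Prog.KeepsArr
  Prog.KeepsReg Test.Holds

variable {G : ℝ → Prop}

/-- Write the rows of the homogenized and rescaled system into array `3`, and add the number of
rows to register `3`. -/
def rowsProg : Prog :=
  .for 4 0 <| .seq (.indInc 3) <|
    .seq (.for 6 1 (.arith .mul (matCell 3 4 6) (matCell 0 4 6) (vecCell 2 6))) <|
    .arith .sub (matCell 3 4 1) (scalarCell 13) (vecCell 1 4)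

/-- Array `13` is a constant zero: the last column is computed as `0 - b`. -/
theorem wp_rowsProg {m n : ℕ} {s : State} (h0 : s.ind 0 = m) (h1 : s.ind 1 = n)
    (h13 : s.mem 13 0 0 = 0) (hG : ∀ i < m, ∀ j < n, G (s.mem 0 i j * s.mem 2 j 0))
    (hG' : ∀ i < m, G (-s.mem 1 i 0)) :
    Wp G rowsProg (m * (n * 4 + 10) + 3) (fun s' => s'.ind 3 = s.ind 3 + m ∧
      ∀ k < m, (∀ j < n, s'.mem 3 k j = s.mem 0 k j * s.mem 2 j 0) ∧
        s'.mem 3 k n = -s.mem 1 k 0) s := by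
  unfold rowsProg
  refine Wp.for (T := n * 4 + 7) (fun i s' => s'.ind 3 = s.ind 3 + i ∧
      ∀ k < i, (∀ j < n, s'.mem 3 k j = s.mem 0 k j * s.mem 2 j 0) ∧
        s'.mem 3 k n = -s.mem 1 k 0) h0 (by simp) (by simp) (by simp) (by simp) ?_
    (fun s' _ h => h)
  intro i hi s' hf h4 hI
  refine Wp.indInc_seq (T := n * 4 + 5) (Wp.seq_frame (T := n * (1 + 3) + 3) (T' := 1)
    (Q := fun s'' => (∀ j < n, s''.mem 3 i j = s.mem 0 i j * s.mem 2 j 0) ∧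
      ∀ k < i, s''.mem 3 k = s'.mem 3 k) ?_ ?_)
  · refine Wp.for (fun l s'' => (∀ j < l, s''.mem 3 i j = s.mem 0 i j * s.mem 2 j 0) ∧
      ∀ k < i, s''.mem 3 k = s'.mem 3 k) (n := n) ?_ (by simp) (by simp) (by simp) (by simp) ?_
      (fun s' _ h => h)
    · simp [hf.ind 1 (by simp), h1]
    · intro j hj s'' hf' h6 hI'
      have e0 : s''.mem 0 = s.mem 0 := by
        rw [hf'.mem 0 (by simp), State.writeInd_mem, hf.mem 0 (by simp)]
      have e2 : s''.mem 2 = s.mem 2 := by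
        rw [hf'.mem 2 (by simp), State.writeInd_mem, hf.mem 2 (by simp)]
      have e4 : s''.ind 4 = i := by
        rw [hf'.ind 4 (by simp)]; simp [h4]
      refine Wp.arith ?_ ⟨?_, ?_⟩
      · simpa [e0, e2, e4, h6] using hG i hi j hj
      · intro l hl
        rcases Nat.lt_succ_iff_lt_or_eq.1 hl with hl | rfl
        · simp [h6, hl.ne, hI'.1 l hl]
        · simp [e0, e2, e4, h6]
      · intro k hk
        ext l
        simp [e4, hk.ne, hI'.2 k hk]
  · intro s'' hf' hI'
    have e1 : s''.mem 1 = s.mem 1 := by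
      rw [hf'.mem 1 (by simp), State.writeInd_mem, hf.mem 1 (by simp)]
    have e13 : s''.mem 13 = s.mem 13 := by
      rw [hf'.mem 13 (by simp), State.writeInd_mem, hf.mem 13 (by simp)]
    have e4 : s''.ind 4 = i := by
      rw [hf'.ind 4 (by simp)]; simp [h4]
    have e1' : s''.ind 1 = n := by
      rw [hf'.ind 1 (by simp)]; simp [hf.ind 1 (by simp), h1]
    have e3 : s''.ind 3 = s.ind 3 + (i + 1) := by
      rw [hf'.ind 3 (by simp)]; simp [hI.1]; ring
    refine Wp.arith ?_ ⟨by simp [e3], ?_⟩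
    · simpa [e1, e13, e4, h13] using hG' i hi
    · intro k hk
      rcases Nat.lt_succ_iff_lt_or_eq.1 hk with hk | rfl
      · simp only [State.writeInd_mem, State.write_mem, Cell.val, Ind.val, e4, hk.ne, false_and,
          and_false, if_false, hI'.2 k hk]
        exact hI.2 k hk
      · refine ⟨fun j hj => ?_, ?_⟩
        · simp [e1', hj.ne, hI'.1 j hj]
        · simp [e1', e4, e1, e13, h13]

/-- Initialize the table in array `4` and the iteration bound in array `10`. -/
def initProg : Prog :=
  .seq (.for 6 2 <| .seq (.copy (matCell 4 6 6) (scalarCell 12)) <|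
    .arith .add (scalarCell 14) (scalarCell 14) (scalarCell 12)) <|
  .seq (.load (scalarCell 10) 16) <|
  .seq (.arith .mul (scalarCell 10) (scalarCell 10) (scalarCell 14)) <|
  .seq (.arith .mul (scalarCell 10) (scalarCell 10) (scalarCell 14)) <|
  .arith .mul (scalarCell 10) (scalarCell 10) (scalarCell 14)

theorem wp_initProg {N : ℕ} {s : State} (h2 : s.ind 2 = N) (h4 : ∀ k j, s.mem 4 k j = 0)
    (h12 : s.mem 12 0 0 = 1) (h14 : s.mem 14 0 0 = 0) (hN : 0 < N)
    (hG : ∀ k : ℕ, k ≤ 16 * N ^ 3 → G k) :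
    Wp G initProg (N * 6 + 11) (fun s' => s'.mem 10 0 0 = (16 * N ^ 3 : ℕ) ∧
      ∀ k, ∀ j < N, s'.mem 4 k j = if k = j then 1 else 0) s := by
  have hb1 : 16 * N ≤ 16 * N ^ 3 := Nat.mul_le_mul_left _ (Nat.le_self_pow (by norm_num) N)
  have hb2 : 16 * N * N ≤ 16 * N ^ 3 := by
    rw [mul_assoc, ← sq]; exact Nat.mul_le_mul_left _ (Nat.pow_le_pow_right hN (by norm_num))
  refine Wp.seq_frame (T := N * (3 + 3) + 3) (T' := 7)
    (Q := fun s' => s'.mem 14 0 0 = N ∧ ∀ k, ∀ j < N, s'.mem 4 k j = if k = j then 1 else 0)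
    ?_ ?_
  · refine Wp.for (fun i s' => s'.mem 14 0 0 = i ∧
      ∀ k j, s'.mem 4 k j = if k = j ∧ j < i then 1 else 0) h2 (by simp) (by simp) (by simp)
      (by simp [h4, h14]) ?_ (fun s' _ h => ⟨h.1, fun k j hj => by simp [h.2, hj]⟩)
    intro i hi s' hf h6 hI
    have e12 : s'.mem 12 = s.mem 12 := hf.mem 12 (by simp)
    refine Wp.copy_seq (T := 1) (Wp.arith ?_ ⟨?_, ?_⟩)
    · simpa [hI.1, e12, h12] using hG (i + 1) (by omega)
    · simp [hI.1, e12, h12]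
    · intro k j
      simp only [State.writeInd_mem, State.write_mem, Cell.val, Ind.val, h6, e12, h12, hI.2]
      by_cases hc : k = i ∧ j = i
      · simp [hc]
      · have hc' : (k = j ∧ j < i + 1) ↔ (k = j ∧ j < i) := by omega
        simp only [hc']
        simp [hc]
  · intro s' hf hI
    have h16 : G ((16 : ℚ) : ℝ) := by simpa using hG 16 (Nat.le_mul_of_pos_right _ (by positivity))
    have hg1 : G (16 * N) := by simpa using hG (16 * N) hb1
    have hg2 : G (16 * N * N) := by simpa using hG (16 * N * N) hb2
    have hg3 : G (16 * N * N * N) := by simpa using hG (16 * N * N * N) (by ring_nf; rfl)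
    refine Wp.load_seq h16 (Wp.arith_seq ?_ (Wp.arith_seq ?_ (Wp.arith ?_ ⟨?_, ?_⟩)))
    · simpa [hI.1] using hg1
    · simpa [hI.1] using hg2
    · simpa [hI.1] using hg3
    · simp [hI.1]; ring
    · intro k j hj
      simp [hI.2 k j hj]

/-! ### The elimination phase -/

/-- Compute the pivot column of the row addressed by register `4` into array `5`. -/
def pivotColProg : Prog :=
  .seq (.for 5 3 <| .seq (.load (vecCell 5 5) 0) <|
    .for 6 2 <| .seq (.arith .mul (scalarCell 6) (matCell 4 5 6) (matCell 3 4 6)) <|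
      .arith .add (vecCell 5 5) (vecCell 5 5) (scalarCell 6)) <|
  .arith .add (vecCell 5 7) (vecCell 5 7) (scalarCell 12)

theorem wp_pivotColProg {N L i : ℕ} {M S : ℕ → ℕ → ℝ} {s : State} (h2 : s.ind 2 = N)
    (h3 : s.ind 3 = L) (h4 : s.ind 4 = i) (h7 : s.ind 7 = N + i) (h12 : s.mem 12 0 0 = 1)
    (hi : N + i < L)
    (hM : ∀ j < N, s.mem 3 i j = M i j) (hS : ∀ k < L, ∀ j < N, s.mem 4 k j = S k j)
    (hG0 : G 0) (hG1 : ∀ k < L, ∀ j < N, G (S k j * M i j))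
    (hG2 : ∀ k < L, ∀ l ≤ N, G (∑ j ∈ range l, S k j * M i j))
    (hG3 : ∀ k < L, G (pivotCol M N S i k)) :
    Wp G pivotColProg (L * (N * 6 + 8) + 5) (fun s' => ∀ k < L, s'.mem 5 k 0 = pivotCol M N S i k)
      s := by
  refine Wp.seq_frame (T := L * (N * 6 + 5 + 3) + 3) (T' := 1)
    (Q := fun s' => ∀ k < L, s'.mem 5 k 0 = ∑ j ∈ range N, S k j * M i j) ?_ ?_
  · refine Wp.for (fun l s' => ∀ k < l, s'.mem 5 k 0 = ∑ j ∈ range N, S k j * M i j) h3 (by simp)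
      (by simp) (by simp) (by simp) ?_ (fun s' _ h => h)
    intro k hk s' hf h5 hI
    refine Wp.load_seq (T := N * (3 + 3) + 3) (by simpa using hG0) ?_
    refine Wp.for (fun l s'' => (∀ k' < k, s''.mem 5 k' 0 = s'.mem 5 k' 0) ∧
        s''.mem 5 k 0 = ∑ j ∈ range l, S k j * M i j) (n := N) ?_ (by simp) (by simp) (by simp)
      ?_ ?_ ?_
    · simp [hf.ind 2 (by simp), h2]
    · refine ⟨fun k' hk' => ?_, ?_⟩
      · simp [h5, hk'.ne]
      · simp [h5]
    · intro j hj s'' hf' h6 hI'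
      have e3 : s''.mem 3 = s.mem 3 := by
        rw [hf'.mem 3 (by simp), State.write_mem_of_ne _ _ _ _ (by simp), hf.mem 3 (by simp)]
      have e4 : s''.mem 4 = s.mem 4 := by
        rw [hf'.mem 4 (by simp), State.write_mem_of_ne _ _ _ _ (by simp), hf.mem 4 (by simp)]
      have e4' : s''.ind 4 = i := by
        rw [hf'.ind 4 (by simp), State.write_ind, hf.ind 4 (by simp), h4]
      have e5 : s''.ind 5 = k := by rw [hf'.ind 5 (by simp), State.write_ind, h5]
      refine Wp.arith_seq (T := 1) ?_ (Wp.arith ?_ ⟨fun k' hk' => ?_, ?_⟩)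
      · simpa [e3, e4, e4', e5, h6, hM j hj, hS k hk j hj] using hG1 k hk j hj
      · have := hG2 k hk (j + 1) hj
        rw [sum_range_succ] at this
        simpa [e3, e4, e4', e5, h6, hM j hj, hS k hk j hj, hI'.2] using this
      · simp [e5, hk'.ne, hI'.1 k' hk']
      · simp [e3, e4, e4', e5, h6, hM j hj, hS k hk j hj, hI'.2, sum_range_succ]
    · intro s'' _ hI' k' hk'
      rcases Nat.lt_succ_iff_lt_or_eq.1 hk' with hk' | rfl
      · simp [hI'.1 k' hk', hI k' hk']
      · simp [hI'.2]
  · intro s' hf hI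
    have e7 : s'.ind 7 = N + i := by rw [hf.ind 7 (by simp), h7]
    have e12 : s'.mem 12 0 0 = 1 := by rw [hf.mem 12 (by simp), h12]
    refine Wp.arith ?_ fun k hk => ?_
    · have := hG3 _ hi
      rw [pivotCol, if_pos rfl] at this
      simpa [e7, e12, hI _ hi] using this
    · by_cases hki : k = N + i
      · subst hki; simp [e7, e12, hI _ hi, pivotCol]
      · simp [e7, hki, hI _ hk, pivotCol]

/-- Compute the squared norm of the first part of array `5` into array `7`. -/
def pivotNormProg : Prog :=
  .seq (.load (scalarCell 7) 0) <|
    .for 6 2 <| .seq (.arith .mul (scalarCell 6) (vecCell 5 6) (vecCell 5 6)) <|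
      .arith .add (scalarCell 7) (scalarCell 7) (scalarCell 6)

theorem wp_pivotNormProg {N : ℕ} {v : ℕ → ℝ} {s : State} (h2 : s.ind 2 = N)
    (h5 : ∀ j < N, s.mem 5 j 0 = v j) (hG0 : G 0) (hG1 : ∀ j < N, G (v j * v j))
    (hG2 : ∀ l ≤ N, G (∑ j ∈ range l, v j * v j)) :
    Wp G pivotNormProg (N * 6 + 5) (fun s' => s'.mem 7 0 0 = ∑ j ∈ range N, v j * v j) s := by
  refine Wp.load_seq (T := N * (3 + 3) + 3) (by simpa using hG0) ?_
  refine Wp.for (fun l s' => s'.mem 7 0 0 = ∑ j ∈ range l, v j * v j) (by simpa using h2)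
    (by simp) (by simp) (by simp) (by simp) ?_ (fun s' _ h => h)
  intro j hj s' hf h6 hI
  have e5 : s'.mem 5 = s.mem 5 := by
    rw [hf.mem 5 (by simp), State.write_mem_of_ne _ _ _ _ (by simp)]
  refine Wp.arith_seq (T := 1) ?_ (Wp.arith ?_ ?_)
  · simpa [e5, h6, h5 j hj] using hG1 j hj
  · have := hG2 (j + 1) hj
    rw [sum_range_succ] at this
    simpa [e5, h6, h5 j hj, hI] using this
  · simp [e5, h6, h5 j hj, hI, sum_range_succ]

/-- The rank-one update of the table in array `4`. -/
def rankOneProg : Prog :=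
  .for 5 3 <| .for 6 2 <| .seq (.arith .mul (scalarCell 6) (vecCell 5 5) (vecCell 5 6)) <|
    .seq (.arith .div (scalarCell 6) (scalarCell 6) (scalarCell 7)) <|
    .arith .sub (matCell 4 5 6) (matCell 4 5 6) (scalarCell 6)

/-- The update can be done in place because pivot column and norm sit in other arrays. The inner
invariant distinguishes entries already visited in row-by-row order. -/
theorem wp_rankOneProg {N L : ℕ} {S : ℕ → ℕ → ℝ} {v : ℕ → ℝ} {ρ : ℝ} {s : State}
    (h2 : s.ind 2 = N) (h3 : s.ind 3 = L) (hNL : N ≤ L) (h5 : ∀ k < L, s.mem 5 k 0 = v k)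
    (h7 : s.mem 7 0 0 = ρ) (hS : ∀ k < L, ∀ j < N, s.mem 4 k j = S k j)
    (hG1 : ∀ k < L, ∀ j < N, G (v k * v j)) (hG2 : ∀ k < L, ∀ j < N, G (v k * v j / ρ))
    (hG3 : ∀ k < L, ∀ j < N, G (S k j - v k * v j / ρ)) :
    Wp G rankOneProg (L * (N * 8 + 6) + 3)
      (fun s' => ∀ k < L, ∀ j < N, s'.mem 4 k j = S k j - v k * v j / ρ) s := by
  refine Wp.for (T := N * (5 + 3) + 3) (fun l s' => ∀ k < L, ∀ j < N, s'.mem 4 k j =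
    if k < l then S k j - v k * v j / ρ else S k j) h3 (by simp) (by simp) (by simp)
    (by simpa using hS) ?_ (fun s' _ h k hk j hj => by simp [h k hk j hj, hk])
  intro k hk s' hf h5' hI
  refine Wp.for (fun l s'' => ∀ k' < L, ∀ j < N, s''.mem 4 k' j =
    if k' < k ∨ (k' = k ∧ j < l) then S k' j - v k' * v j / ρ else S k' j) (n := N) ?_ (by simp)
    (by simp) (by simp) (by simpa using hI) ?_ ?_
  · rw [hf.ind 2 (by simp), h2]
  · intro j hj s'' hf' h6 hI'
    have e5 : s''.mem 5 = s.mem 5 := by rw [hf'.mem 5 (by simp), hf.mem 5 (by simp)]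
    have e7 : s''.mem 7 = s.mem 7 := by rw [hf'.mem 7 (by simp), hf.mem 7 (by simp)]
    have e5' : s''.ind 5 = k := by rw [hf'.ind 5 (by simp), h5']
    have e4 : s''.mem 4 k j = S k j := by rw [hI' k hk j hj, if_neg (by omega)]
    refine Wp.arith_seq (T := 3) ?_ (Wp.arith_seq (T := 1) ?_ (Wp.arith ?_ ?_))
    · simpa [e5, e5', h6, h5 k hk, h5 j (by omega)] using hG1 k hk j hj
    · simpa [e5, e5', h6, h5 k hk, h5 j (by omega), e7, h7] using hG2 k hk j hj
    · simpa [e5, e5', h6, h5 k hk, h5 j (by omega), e7, h7, e4] using hG3 k hk j hj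
    · intro k' hk' j' hj'
      by_cases hc : k' = k ∧ j' = j
      · obtain ⟨rfl, rfl⟩ := hc
        simp [e5, e5', h6, h5 k' hk, h5 j' (by omega), e7, h7, e4]
      · have hc' : (k' < k ∨ (k' = k ∧ j' < j + 1)) ↔ (k' < k ∨ (k' = k ∧ j' < j)) := by omega
        simp only [hc']
        simp [e5', h6, hc, hI' k' hk' j' hj']
  · intro s'' _ hI' k' hk' j hj
    simp only [State.writeInd_mem]
    rw [hI' k' hk' j hj]
    have hc' : (k' < k ∨ (k' = k ∧ j < N)) ↔ k' < k + 1 := by omega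
    simp only [hc']

/-- All numbers occurring in the computation of the table are good. -/
structure SafeElim (G : ℝ → Prop) (M : ℕ → ℕ → ℝ) (N m : ℕ) : Prop where
  zero : G 0
  mul : ∀ i < m, ∀ k < N + m, ∀ j < N, G (projTable M N i k j * M i j)
  partialCol : ∀ i < m, ∀ k < N + m, ∀ l ≤ N, G (∑ j ∈ range l, projTable M N i k j * M i j)
  col : ∀ i < m, ∀ k < N + m, G (pivotCol M N (projTable M N i) i k)
  colMul : ∀ i < m, ∀ k < N + m, ∀ j < N,
    G (pivotCol M N (projTable M N i) i k * pivotCol M N (projTable M N i) i j)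
  partialNorm : ∀ i < m, ∀ l ≤ N, G (∑ j ∈ range l,
    pivotCol M N (projTable M N i) i j * pivotCol M N (projTable M N i) i j)
  div : ∀ i < m, ∀ k < N + m, ∀ j < N,
    G (pivotCol M N (projTable M N i) i k * pivotCol M N (projTable M N i) i j /
      pivotNorm M N (projTable M N i) i)
  table : ∀ i ≤ m, ∀ k < N + m, ∀ j < N, G (projTable M N i k j)

/-- Compute the table of the projection onto the kernel. -/
def elimProg : Prog :=
  .seq (.indSet 7 (.reg 2)) <| .for 4 0 <| .seq pivotColProg <| .seq pivotNormProg <|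
    .seq rankOneProg (.indInc 7)

theorem wp_elimProg {N m : ℕ} {M : ℕ → ℕ → ℝ} {s : State} (h0 : s.ind 0 = m) (h2 : s.ind 2 = N)
    (h3 : s.ind 3 = N + m) (h12 : s.mem 12 0 0 = 1) (hM : ∀ i < m, ∀ j < N, s.mem 3 i j = M i j)
    (hS : ∀ k < N + m, ∀ j < N, s.mem 4 k j = projTable M N 0 k j) (hG : SafeElim G M N m) :
    Wp G elimProg (m * ((N + m) * (N * 14 + 14) + N * 6 + 20) + 5)
      (fun s' => ∀ k < N + m, ∀ j < N, s'.mem 4 k j = projTable M N m k j) s := by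
  refine Wp.mono (T := m * ((N + m) * (N * 14 + 14) + N * 6 + 17 + 3) + 3 + 2)
    (Wp.indSet_seq ?_) (le_of_eq (by ring)) (fun _ _ h => h)
  refine Wp.for (fun i s' => s'.ind 7 = N + i ∧ ∀ k < N + m, ∀ j < N,
    s'.mem 4 k j = projTable M N i k j) (by simpa using h0) (by simp)
    (by simp [pivotColProg, pivotNormProg, rankOneProg])
    (by simp [pivotColProg, pivotNormProg, rankOneProg]) (by simpa [h2] using hS) ?_
    (fun s' _ h => h.2)
  intro i hi s' hf h4 hI
  have e2 : s'.ind 2 = N := by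
    rw [hf.ind 2 (by simp [pivotColProg, pivotNormProg, rankOneProg])]; simp [h2]
  have e3 : s'.ind 3 = N + m := by
    rw [hf.ind 3 (by simp [pivotColProg, pivotNormProg, rankOneProg])]; simp [h3]
  have e12 : s'.mem 12 = s.mem 12 := by
    rw [hf.mem 12 (by simp [pivotColProg, pivotNormProg, rankOneProg])]; simp
  have eM : s'.mem 3 = s.mem 3 := by
    rw [hf.mem 3 (by simp [pivotColProg, pivotNormProg, rankOneProg])]; simp
  refine (Wp.seq_frame (wp_pivotColProg (N := N) (L := N + m) (i := i) (M := M)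
    (S := projTable M N i) e2 e3 h4 hI.1 (by rw [e12, h12]) (by omega)
    (fun j hj => by rw [eM, hM i hi j hj]) hI.2 hG.zero (hG.mul i hi) (hG.partialCol i hi)
    (hG.col i hi)) fun s1 hf1 hQ1 => ?_ :
      Wp G _ (_ + (N * 6 + 5 + ((N + m) * (N * 8 + 6) + 3 + 1 + 1) + 1) + 1) _ s').mono
        (by ring_nf; omega) (fun _ _ h => h)
  refine Wp.seq_frame (T := N * 6 + 5) (T' := (N + m) * (N * 8 + 6) + 3 + 1 + 1)
    (wp_pivotNormProg (N := N) (v := pivotCol M N (projTable M N i) i)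
    (by rw [hf1.ind 2 (by simp [pivotColProg]), e2]) (fun j hj => hQ1 j (by omega)) hG.zero
    (fun j hj => hG.colMul i hi j (by omega) j hj) (hG.partialNorm i hi)) fun s2 hf2 hQ2 => ?_
  refine Wp.seq_frame (T := (N + m) * (N * 8 + 6) + 3) (T' := 1) (wp_rankOneProg (N := N) (L := N + m) (S := projTable M N i)
    (v := pivotCol M N (projTable M N i) i) (ρ := pivotNorm M N (projTable M N i) i)
    ?_ ?_ (by omega) ?_ hQ2 ?_ (hG.colMul i hi) (hG.div i hi) (hG.table (i + 1) hi))
      fun s3 hf3 hQ3 => Wp.indInc ?_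
  · rw [hf2.ind 2 (by simp [pivotNormProg]), hf1.ind 2 (by simp [pivotColProg]), e2]
  · rw [hf2.ind 3 (by simp [pivotNormProg]), hf1.ind 3 (by simp [pivotColProg]), e3]
  · intro k hk
    rw [hf2.mem 5 (by simp [pivotNormProg]), hQ1 k hk]
  · intro k hk j hj
    rw [hf2.mem 4 (by simp [pivotNormProg]), hf1.mem 4 (by simp [pivotColProg]), hI.2 k hk j hj]
  · refine ⟨?_, fun k hk j hj => hQ3 k hk j hj⟩
    simp only [State.writeInd_ind]
    rw [hf3.ind 7 (by simp [rankOneProg]), hf2.ind 7 (by simp [pivotNormProg]),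
      hf1.ind 7 (by simp [pivotColProg]), hI.1]
    simp
    ring

/-! ### The perceptron phase -/

/-- Let register `7` point to a nonpositive entry of the first part of array `9`, if any. -/
def scanProg : Prog :=
  .seq (.indSet 7 (.reg 2)) <| .for 6 2 <|
    .ite (.le (vecCell 9 6) (scalarCell 13)) (.indSet 7 (.reg 6)) .skip

theorem wp_scanProg {N : ℕ} {s : State} (h2 : s.ind 2 = N) (h13 : s.mem 13 0 0 = 0) :
    Wp G scanProg (N * 5 + 5) (fun s' => (s'.ind 7 < N ∧ s.mem 9 (s'.ind 7) 0 ≤ 0) ∨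
      (s'.ind 7 = N ∧ ∀ j < N, 0 < s.mem 9 j 0)) s := by
  refine Wp.indSet_seq (T := N * (2 + 3) + 3) ?_
  refine Wp.for (fun l s' => (s'.ind 7 < N ∧ s.mem 9 (s'.ind 7) 0 ≤ 0) ∨
      (s'.ind 7 = N ∧ ∀ j < l, 0 < s.mem 9 j 0)) (by simpa using h2) (by simp) (by simp) (by simp)
      (by simp [h2]) ?_ (fun s' _ h => h)
  intro j hj s' hf h6 hI
  have e9 : s'.mem 9 = s.mem 9 := by rw [hf.mem 9 (by simp)]; simp
  have e13 : s'.mem 13 = s.mem 13 := by rw [hf.mem 13 (by simp)]; simp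
  refine Wp.ite (fun hb => Wp.indSet ?_) (fun hb => Wp.skip ?_)
  · left
    simp only [Test.Holds, Cell.val, Ind.val, e9, e13, h6, h13] at hb
    simpa [h6, hj] using hb
  · simp only [Test.Holds, Cell.val, Ind.val, e9, e13, h6, h13, not_le] at hb
    refine hI.imp (fun h => by simpa using h) (fun h => ⟨by simpa using h.1, fun l hl => ?_⟩)
    rcases Nat.lt_succ_iff_lt_or_eq.1 hl with hl | rfl
    exacts [h.2 l hl, hb]

/-- Add the column of the table addressed by register `7` to the vector in array `9`. -/
def updateProg : Prog :=
  .seq (.arith .add (vecCell 8 7) (vecCell 8 7) (scalarCell 12)) <|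
    .for 5 3 <| .arith .add (vecCell 9 5) (vecCell 9 5) (matCell 4 5 7)

/-- Array `8` holds the vector `y`, and array `9` its product with the table `S`. -/
def HoldsProduct (S : ℕ → ℕ → ℝ) (N L : ℕ) (y : ℕ → ℕ) (s : State) : Prop :=
  (∀ j < N, s.mem 8 j 0 = y j) ∧ ∀ k < L, s.mem 9 k 0 = tableMul S N y k

/-- Raising `y r` by one adds column `r` of the table to the product. This costs `O(L)` rather than
a full matrix-vector product, which is what yields `O(n ^ 4)` overall. -/
theorem wp_updateProg {N L r : ℕ} {S : ℕ → ℕ → ℝ} {y : ℕ → ℕ} {s : State} (h3 : s.ind 3 = L)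
    (h7 : s.ind 7 = r) (hr : r < N) (h12 : s.mem 12 0 0 = 1)
    (hS : ∀ k < L, ∀ j < N, s.mem 4 k j = S k j) (hy : HoldsProduct S N L y s)
    (hG1 : G (y r + 1 : ℕ))
    (hG2 : ∀ k < L, G (tableMul S N (Function.update y r (y r + 1)) k)) :
    Wp G updateProg (L * 4 + 5) (HoldsProduct S N L (Function.update y r (y r + 1))) s := by
  refine Wp.arith_seq (T := L * (1 + 3) + 3) ?_ ?_
  · simpa [h7, h12, hy.1 r hr] using hG1
  · refine Wp.for (fun l s' => (∀ j < N, s'.mem 8 j 0 = Function.update y r (y r + 1) j) ∧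
      ∀ k < L, s'.mem 9 k 0 = if k < l then tableMul S N (Function.update y r (y r + 1)) k
        else tableMul S N y k) (by simpa using h3) (by simp) (by simp) (by simp) ?_ ?_ ?_
    · refine ⟨fun j hj => ?_, fun k hk => by simp [hy.2 k hk]⟩
      by_cases hjr : j = r
      · subst hjr; simp [h7, h12, hy.1 j hj]
      · simp [h7, hjr, hy.1 j hj]
    · intro k hk s' hf h5 hI
      have e4 : s'.mem 4 = s.mem 4 := by
        rw [hf.mem 4 (by simp), State.write_mem_of_ne _ _ _ _ (by simp)]
      have e7 : s'.ind 7 = r := by rw [hf.ind 7 (by simp), State.write_ind, h7]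
      have e9 : s'.mem 9 k 0 = tableMul S N y k := by simpa using hI.2 k hk
      refine Wp.arith ?_ ⟨by simpa using hI.1, fun k' hk' => ?_⟩
      · have := hG2 k hk
        rw [tableMul_update _ _ _ _ hr] at this
        simpa [h5, e7, e4, hS k hk r hr, e9] using this
      · by_cases hkk : k' = k
        · subst hkk
          simp [h5, e7, e4, hS k' hk r hr, e9, tableMul_update _ _ _ _ hr]
        · have hc : k' < k + 1 ↔ k' < k := by omega
          simp only [hc]
          simp [h5, hkk, hI.2 k' hk']
    · intro s' _ hI
      exact ⟨hI.1, fun k hk => by simp [hI.2 k hk, hk]⟩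

/-- One round of the perceptron method. -/
def roundProg : Prog :=
  .seq scanProg <| .seq (.ite (.indLt (.reg 7) (.reg 2)) updateProg .skip) <|
    .arith .add (scalarCell 11) (scalarCell 11) (scalarCell 12)

/-- The perceptron method. -/
def perceptronProg : Prog :=
  .while (.lt (scalarCell 11) (scalarCell 10)) roundProg

/-- After `k` rounds, either `k` columns have been added up to a short vector, or a positive
vector has been found. -/
def RoundInv (S : ℕ → ℕ → ℝ) (N L k : ℕ) (y : ℕ → ℕ) (s : State) : Prop :=
  HoldsProduct S N L y s ∧ ∑ j ∈ range N, y j ≤ k ∧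
    ((∑ j ∈ range N, y j = k ∧ ∑ j ∈ range N, tableMul S N y j ^ 2 ≤ k) ∨
      ∀ j < N, 0 < tableMul S N y j)

theorem le_of_sum_le {N k : ℕ} {y : ℕ → ℕ} (h : ∑ j ∈ range N, y j ≤ k) {j : ℕ} (hj : j < N) :
    y j ≤ k :=
  (single_le_sum (fun _ _ => Nat.zero_le _) (mem_range.2 hj)).trans h

/-- Once `z` is positive, the scan finds nothing and only the counter advances. The bound on the sum
of `y` is kept in that case too, since it controls the sizes. -/
theorem wp_roundProg {N L i K k : ℕ} {M S : ℕ → ℕ → ℝ} {y : ℕ → ℕ} {s : State}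
    (hP : IsProjTable M N i S) (hNL : N ≤ L) (h2 : s.ind 2 = N) (h3 : s.ind 3 = L)
    (h12 : s.mem 12 0 0 = 1) (h13 : s.mem 13 0 0 = 0)
    (hS : ∀ k < L, ∀ j < N, s.mem 4 k j = S k j) (hcnt : s.mem 11 0 0 = k) (hk : k < K)
    (hI : RoundInv S N L k y s) (hGn : ∀ k ≤ K, G (k : ℝ))
    (hGz : ∀ y : ℕ → ℕ, ∑ j ∈ range N, y j ≤ K → ∀ k < L, G (tableMul S N y k)) :
    Wp G roundProg (N * 5 + L * 4 + 14)
      (fun s' => s'.mem 11 0 0 = (k + 1 : ℕ) ∧ ∃ y, RoundInv S N L (k + 1) y s') s := by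
  obtain ⟨hy, hle, hor⟩ := hI
  refine (Wp.seq_frame (T' := L * 4 + 5 + 1 + 1 + 1) (wp_scanProg h2 h13)
    fun s1 hf1 hQ1 => ?_).mono (by omega) (fun _ _ h => h)
  have hy1 : HoldsProduct S N L y s1 := by
    unfold HoldsProduct
    rw [hf1.mem 8 (by simp [scanProg]), hf1.mem 9 (by simp [scanProg])]
    exact hy
  have h12' : s1.mem 12 0 0 = 1 := by rw [hf1.mem 12 (by simp [scanProg]), h12]
  refine Wp.seq_frame (T := L * 4 + 5 + 1) (T' := 1) (Q := fun s' => ∃ y, RoundInv S N L (k + 1) y s')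
    (Wp.ite (fun hb => ?_) fun hb => ?_) ?_
  · have e2 : s1.ind 2 = N := by rw [hf1.ind 2 (by simp [scanProg]), h2]
    simp only [Test.Holds, Ind.val, e2] at hb
    have hz : tableMul S N y (s1.ind 7) ≤ 0 := by
      rw [← hy.2 _ (by omega)]
      rcases hQ1 with h | h
      · exact h.2
      · omega
    refine (wp_updateProg (N := N) (y := y) (by rw [hf1.ind 3 (by simp [scanProg]), h3]) rfl hb h12'
      (by rw [hf1.mem 4 (by simp [scanProg])]; exact hS) hy1 ?_ ?_).mono le_rfl ?_
    · exact hGn _ ((Nat.succ_le_succ (le_of_sum_le hle hb)).trans hk)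
    · refine hGz _ ?_
      rw [sum_update_succ _ _ hb]; omega
    · intro s' _ h
      refine ⟨_, h, by rw [sum_update_succ _ _ hb]; omega, Or.inl ?_⟩
      rcases hor with h' | h'
      · refine ⟨by rw [sum_update_succ _ _ hb]; omega, ?_⟩
        refine (hP.sum_sq_tableMul_update y hb hz).trans ?_
        push_cast
        linarith [h'.2]
      · exact absurd hz (h' _ hb).not_ge
  · have e2 : s1.ind 2 = N := by rw [hf1.ind 2 (by simp [scanProg]), h2]
    simp only [Test.Holds, Ind.val, e2] at hb
    refine Wp.mono (T := 1) (Wp.skip ⟨y, hy1, by omega, Or.inr fun j hj => ?_⟩) (by omega)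
      (fun _ _ h => h)
    rw [← hy.2 j (by omega)]
    rcases hQ1 with h | h
    · omega
    · exact h.2 j hj
  · rintro s2 hf2 ⟨y', hy', hle', hor'⟩
    have e11 : s2.mem 11 0 0 = k := by
      rw [hf2.mem 11 (by simp [updateProg]), hf1.mem 11 (by simp [scanProg]), hcnt]
    have e12 : s2.mem 12 0 0 = 1 := by rw [hf2.mem 12 (by simp [updateProg]), h12']
    refine Wp.arith ?_ ⟨by simp [e11, e12], y', ⟨by simpa using hy'.1, by simpa using hy'.2⟩, hle',
      hor'⟩
    simpa [e11, e12] using hGn (k + 1) hk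

theorem wp_perceptronProg {N L i K : ℕ} {M S : ℕ → ℕ → ℝ} {s : State}
    (hP : IsProjTable M N i S) (hNL : N ≤ L) (h2 : s.ind 2 = N) (h3 : s.ind 3 = L)
    (h10 : s.mem 10 0 0 = K) (h12 : s.mem 12 0 0 = 1) (h13 : s.mem 13 0 0 = 0)
    (h11 : s.mem 11 0 0 = 0) (h8 : ∀ j, s.mem 8 j 0 = 0) (h9 : ∀ j, s.mem 9 j 0 = 0)
    (hS : ∀ k < L, ∀ j < N, s.mem 4 k j = S k j) (hGn : ∀ k ≤ K, G (k : ℝ))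
    (hGz : ∀ y : ℕ → ℕ, ∑ j ∈ range N, y j ≤ K → ∀ k < L, G (tableMul S N y k)) :
    Wp G perceptronProg (K * (N * 5 + L * 4 + 15) + 1) (fun s' => ∃ y, RoundInv S N L K y s') s := by
  refine Wp.while (T := N * 5 + L * 4 + 14) (fun k s' => Frame roundProg s s' ∧
    s'.mem 11 0 0 = k ∧ ∃ y, RoundInv S N L k y s') ?_ ?_ ?_
  · refine ⟨Frame.refl _ _, by simpa using h11, fun _ => 0, ⟨by simpa using fun j _ => h8 j, ?_⟩,
      by simp, Or.inl (by simp [tableMul])⟩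
    intro k _
    simp [h9, tableMul]
  · rintro k hk s' ⟨hf, hcnt, y, hy⟩
    have e : roundProg.KeepsArr 4 ∧ roundProg.KeepsArr 10 ∧ roundProg.KeepsArr 12 ∧
        roundProg.KeepsArr 13 ∧ roundProg.KeepsReg 2 ∧ roundProg.KeepsReg 3 := by
      simp [roundProg, scanProg, updateProg]
    obtain ⟨e4, e10, e12, e13, e2, e3⟩ := e
    refine ⟨?_, ?_⟩
    · simp only [Test.Holds, Cell.val, Ind.val]
      rw [hcnt, hf.mem 10 e10, h10]
      exact_mod_cast hk
    · refine (wp_roundProg hP hNL (by rw [hf.ind 2 e2, h2]) (by rw [hf.ind 3 e3, h3])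
        (by rw [hf.mem 12 e12, h12]) (by rw [hf.mem 13 e13, h13])
        (by rw [hf.mem 4 e4]; exact hS) hcnt hk hy hGn hGz).frame fun s'' hf' h => ?_
      exact ⟨hf.trans hf', h⟩
  · rintro s' ⟨hf, hcnt, h⟩
    refine ⟨?_, h⟩
    simp only [Test.Holds, Cell.val, Ind.val]
    rw [hcnt, hf.mem 10 (by simp [roundProg, scanProg, updateProg]), h10]
    exact lt_irrefl _

/-! ### Writing the output -/

/-- Write the point obtained from the positive vector in array `9`. -/
def pointProg : Prog :=
  .seq (.for 6 1 <| .seq (.arith .div (scalarCell 6) (vecCell 9 6) (vecCell 9 1)) <|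
    .arith .mul (vecCell 0 6) (scalarCell 6) (vecCell 2 6)) (.indSet 0 (.const 0))

theorem wp_pointProg {n : ℕ} {u z : ℕ → ℝ} {s : State} (h1 : s.ind 1 = n)
    (hu : ∀ j < n, s.mem 2 j 0 = u j) (hz : ∀ j ≤ n, s.mem 9 j 0 = z j)
    (hG1 : ∀ j < n, G (z j / z n)) (hG2 : ∀ j < n, G (z j / z n * u j)) :
    Wp G pointProg (n * 6 + 5) (fun s' => s'.ind 0 = 0 ∧ ∀ j < n, s'.mem 0 j 0 = z j / z n * u j)
      s := by
  refine Wp.seq (T := n * (3 + 3) + 3) (T' := 1) ?_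
  refine Wp.for (fun l s' => ∀ j < l, s'.mem 0 j 0 = z j / z n * u j) h1 (by simp) (by simp)
    (by simp) (by simp) ?_ (fun s' _ h => Wp.indSet ⟨by simp, by simpa using h⟩)
  intro j hj s' hf h6 hI
  have e2 : s'.mem 2 = s.mem 2 := hf.mem 2 (by simp)
  have e9 : s'.mem 9 = s.mem 9 := hf.mem 9 (by simp)
  have e1 : s'.ind 1 = n := by rw [hf.ind 1 (by simp), h1]
  refine Wp.arith_seq (T := 1) ?_ (Wp.arith ?_ fun l hl => ?_)
  · simpa [e9, e1, h6, hz j hj.le, hz n le_rfl] using hG1 j hj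
  · simpa [e9, e1, h6, hz j hj.le, hz n le_rfl, e2, hu j hj] using hG2 j hj
  · rcases Nat.lt_succ_iff_lt_or_eq.1 hl with hl | rfl
    · simp [h6, hl.ne, hI l hl]
    · simp [e9, e1, h6, hz l hj.le, hz n le_rfl, e2, hu l hj]

/-- Write the certificate obtained from the vectors in arrays `8` and `9`. -/
def certificateProg : Prog :=
  .seq (.arith .add (scalarCell 8) (scalarCell 8) (scalarCell 12)) <|
  .seq (.indSet 7 (.reg 2)) <|
  .seq (.for 6 0 <| .seq (.copy (vecCell 0 6) (vecCell 9 7)) (.indInc 7)) <|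
  .seq (.for 6 1 <| .arith .div (vecCell 1 6) (vecCell 8 6) (vecCell 2 6)) <|
  .indSet 0 (.const 1)

/-- Increasing `y 0` by one forces `w ≠ 0` even if all the weight of `y` lies on the homogenizing
coordinate. The product in array `9` is deliberately not updated. -/
theorem wp_certificateProg {m n N : ℕ} {u z : ℕ → ℝ} {y : ℕ → ℕ} {s : State} (h0 : s.ind 0 = m)
    (h1 : s.ind 1 = n) (h2 : s.ind 2 = N) (hnN : n ≤ N) (hN : 0 < N) (h12 : s.mem 12 0 0 = 1)
    (hu : ∀ j < n, s.mem 2 j 0 = u j) (hy : ∀ j < N, s.mem 8 j 0 = y j)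
    (hz : ∀ k < N + m, s.mem 9 k 0 = z k) (hG1 : G (y 0 + 1 : ℕ))
    (hG2 : ∀ j < n, G ((y j + if j = 0 then 1 else 0 : ℕ) / u j)) :
    Wp G certificateProg (m * 6 + n * 4 + 13) (fun s' => s'.ind 0 = 1 ∧
      (∀ i < m, s'.mem 0 i 0 = z (N + i)) ∧
      ∀ j < n, s'.mem 1 j 0 = (y j + if j = 0 then 1 else 0 : ℕ) / u j) s := by
  refine Wp.mono (T := (m * (3 + 3) + 3) + ((n * (1 + 3) + 3) + 1 + 1) + 1 + 2 + 2)
    (Wp.arith_seq ?_ (Wp.indSet_seq (Wp.seq_frame (Q := fun s' => ∀ i < m, s'.mem 0 i 0 = z (N + i))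
      ?_ fun s1 hf1 hQ1 => ?_))) (by omega) (fun _ _ h => h)
  · simpa [hy 0 hN, h12] using hG1
  · refine Wp.for (fun l s' => s'.ind 7 = N + l ∧ ∀ i < l, s'.mem 0 i 0 = z (N + i))
      (by simpa using h0) (by simp) (by simp) (by simp) (by simp [h2]) ?_ (fun s' _ h => h.2)
    intro i hi s' hf h6 hI
    have e9 : s'.mem 9 = s.mem 9 := by
      rw [hf.mem 9 (by simp), State.writeInd_mem, State.write_mem_of_ne _ _ _ _ (by simp)]
    refine Wp.copy_seq (T := 1) (Wp.indInc ⟨by simp [hI.1]; ring, fun l hl => ?_⟩)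
    rcases Nat.lt_succ_iff_lt_or_eq.1 hl with hl | rfl
    · simp [h6, hl.ne, hI.2 l hl]
    · simp [h6, e9, hI.1, hz (N + l) (by omega)]
  · refine Wp.seq (T := n * (1 + 3) + 3) (T' := 1) ?_
    refine Wp.for (fun l s' => (∀ i < m, s'.mem 0 i 0 = z (N + i)) ∧
      ∀ j < l, s'.mem 1 j 0 = (y j + if j = 0 then 1 else 0 : ℕ) / u j) (n := n) ?_ (by simp)
      (by simp) (by simp) (by simpa using hQ1) ?_
      (fun s' _ h => Wp.indSet ⟨by simp, by simpa using h⟩)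
    · rw [hf1.ind 1 (by simp)]; simp [h1]
    · intro j hj s' hf h6 hI
      have e8 : s'.mem 8 j 0 = (y j + if j = 0 then 1 else 0 : ℕ) := by
        rw [hf.mem 8 (by simp), hf1.mem 8 (by simp)]
        by_cases hj0 : j = 0
        · simp [hj0, hy 0 hN, h12]
        · simp [hj0, hy j (by omega)]
      have e2 : s'.mem 2 = s.mem 2 := by
        rw [hf.mem 2 (by simp), hf1.mem 2 (by simp), State.writeInd_mem,
          State.write_mem_of_ne _ _ _ _ (by simp)]
      refine Wp.arith ?_ ⟨by simpa using hI.1, fun l hl => ?_⟩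
      · simp only [ArithOp.eval, Cell.val, Ind.val, h6, e8, e2, hu j hj]
        exact hG2 j hj
      · rcases Nat.lt_succ_iff_lt_or_eq.1 hl with hl | rfl
        · simpa [h6, hl.ne] using hI.2 l hl
        · simp only [State.writeInd_mem, State.write_mem, ArithOp.eval, Cell.val, Ind.val, h6, e8, e2, hu l hj]
          simp

/-- The number of rounds of the perceptron method for `n` variables. -/
def rounds (n : ℕ) : ℕ := 16 * (n + 1) ^ 3

/-- The product of the projection table with `y`. -/
noncomputable def projMul (M : ℕ → ℕ → ℝ) (m n : ℕ) (y : ℕ → ℕ) : ℕ → ℝ :=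
  tableMul (projTable M (n + 1) m) (n + 1) y

/-- All numbers occurring in the computation are good. -/
structure SafeInput (G : ℝ → Prop) (M : ℕ → ℕ → ℝ) (u : ℕ → ℝ) (m n : ℕ) : Prop where
  elim : SafeElim G M (n + 1) m
  entry : ∀ i < m, ∀ j ≤ n, G (M i j)
  nat : ∀ k ≤ rounds n + 1, G (k : ℕ)
  product : ∀ y : ℕ → ℕ, ∑ j ∈ range (n + 1), y j ≤ rounds n →
    ∀ k < n + 1 + m, G (projMul M m n y k)
  ratio : ∀ y : ℕ → ℕ, ∑ j ∈ range (n + 1), y j ≤ rounds n →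
    ∀ j < n, G (projMul M m n y j / projMul M m n y n)
  point : ∀ y : ℕ → ℕ, ∑ j ∈ range (n + 1), y j ≤ rounds n →
    ∀ j < n, G (projMul M m n y j / projMul M m n y n * u j)
  weight : ∀ k ≤ rounds n + 1, ∀ j < n, G ((k : ℕ) / u j)

/-- The arrays `0` and `1` hold a point obtained from the positive vector `z`. -/
def HoldsPoint (z u : ℕ → ℝ) (n : ℕ) (s : State) : Prop :=
  s.ind 0 = 0 ∧ (∀ j < n + 1, 0 < z j) ∧ ∀ j < n, s.mem 0 j 0 = z j / z n * u j

/-- The arrays `0` and `1` hold a certificate obtained from the short vector `z`. -/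
def HoldsCertificate (z u : ℕ → ℝ) (y : ℕ → ℕ) (m n : ℕ) (s : State) : Prop :=
  s.ind 0 = 1 ∧ ∑ j ∈ range (n + 1), y j = rounds n ∧
    ∑ j ∈ range (n + 1), z j ^ 2 ≤ rounds n ∧ (∀ i < m, s.mem 0 i 0 = z (n + 1 + i)) ∧
    ∀ j < n, s.mem 1 j 0 = (y j + if j = 0 then 1 else 0 : ℕ) / u j

/-- Produce the output from the vectors in arrays `8` and `9`. -/
def outputProg : Prog :=
  .seq scanProg <| .ite (.indLt (.reg 7) (.reg 2)) certificateProg pointProg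

/-- A fresh scan is made because the last round may have changed `z` after its own scan. A
nonpositive entry excludes the positive alternative of `RoundInv`, leaving the short vector. -/
theorem wp_outputProg {m n : ℕ} {M : ℕ → ℕ → ℝ} {u : ℕ → ℝ} {y : ℕ → ℕ} {s : State}
    (h0 : s.ind 0 = m) (h1 : s.ind 1 = n) (h2 : s.ind 2 = n + 1) (h12 : s.mem 12 0 0 = 1)
    (h13 : s.mem 13 0 0 = 0) (hu : ∀ j < n, s.mem 2 j 0 = u j)
    (hy : RoundInv (projTable M (n + 1) m) (n + 1) (n + 1 + m) (rounds n) y s)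
    (hG : SafeInput G M u m n) :
    Wp G outputProg (m * 6 + n * 11 + 25)
      (fun s' => HoldsPoint (projMul M m n y) u n s' ∨
        HoldsCertificate (projMul M m n y) u y m n s') s := by
  obtain ⟨⟨hy8, hy9⟩, hle, hor⟩ := hy
  refine (Wp.seq_frame (T' := m * 6 + n * 6 + 13 + 1) (wp_scanProg h2 h13)
    fun s1 hf1 hQ1 => ?_).mono (by omega) (fun _ _ h => h)
  have e2 : s1.ind 2 = n + 1 := by rw [hf1.ind 2 (by simp [scanProg]), h2]
  have e9 : ∀ k < n + 1 + m, s1.mem 9 k 0 = projMul M m n y k := by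
    rw [hf1.mem 9 (by simp [scanProg])]; exact hy9
  have eu : ∀ j < n, s1.mem 2 j 0 = u j := by rw [hf1.mem 2 (by simp [scanProg])]; exact hu
  have e1 : s1.ind 1 = n := by rw [hf1.ind 1 (by simp [scanProg]), h1]
  refine Wp.ite (fun hb => ?_) fun hb => ?_
  · simp only [Test.Holds, Ind.val, e2] at hb
    have hz : projMul M m n y (s1.ind 7) ≤ 0 := by
      rw [projMul, ← hy9 _ (by omega)]
      rcases hQ1 with h | h
      · exact h.2
      · omega
    have hor' := hor.resolve_right fun h => absurd hz (h _ hb).not_ge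
    refine (wp_certificateProg (N := n + 1) (y := y) (u := u) (z := projMul M m n y)
      (by rw [hf1.ind 0 (by simp [scanProg]), h0]) e1 e2 (by omega) (by omega)
      (by rw [hf1.mem 12 (by simp [scanProg]), h12]) eu
      (by rw [hf1.mem 8 (by simp [scanProg])]; exact hy8) e9
      (hG.nat _ (Nat.succ_le_succ (le_of_sum_le hle (by omega)))) fun j hj => ?_).mono (by omega)
      fun s' _ h => Or.inr ⟨h.1, hor'.1, hor'.2, h.2⟩
    refine hG.weight _ (Nat.add_le_add (le_of_sum_le hle (by omega)) ?_) j hj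
    split_ifs <;> omega
  · simp only [Test.Holds, Ind.val, e2] at hb
    refine (wp_pointProg (z := projMul M m n y) e1 eu (fun j hj => e9 j (by omega))
      (hG.ratio y hle) (hG.point y hle)).mono (by omega) fun s' _ h => Or.inl ⟨h.1, ?_, h.2⟩
    intro j hj
    rw [projMul, ← hy9 j (by omega)]
    rcases hQ1 with h | h
    · omega
    · exact h.2 j hj

/-! ### The whole program and its running time -/

/-- The algorithm. -/
def feasibilityProg : Prog :=
  .seq (.indSet 2 (.reg 1)) <| .seq (.indInc 2) <| .seq (.indSet 3 (.reg 2)) <|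
    .seq (.load (scalarCell 12) 1) <| .seq rowsProg <| .seq initProg <| .seq elimProg <|
    .seq perceptronProg outputProg

/-- The homogenized and rescaled system. -/
noncomputable def homogenize (A : ℕ → ℕ → ℝ) (b u : ℕ → ℝ) (n k j : ℕ) : ℝ :=
  if j < n then A k j * u j else -b k

/-- A bound on the running time. -/
def timeBound (m n : ℕ) : ℕ :=
  ((m * (n * 4 + 10) + 3) + (((n + 1) * 6 + 11) +
    ((m * ((n + 1 + m) * ((n + 1) * 14 + 14) + (n + 1) * 6 + 20) + 5) +
    ((rounds n * ((n + 1) * 5 + (n + 1 + m) * 4 + 15) + 1) + (m * 6 + n * 11 + 25) + 1) + 1) + 1) +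
    1) + 8

theorem wp_feasibilityProg {m n : ℕ} {A : ℕ → ℕ → ℝ} {b u : ℕ → ℝ} {s : State}
    (h0 : s.ind 0 = m) (h1 : s.ind 1 = n) (hA : ∀ i < m, ∀ j < n, s.mem 0 i j = A i j)
    (hb : ∀ i < m, s.mem 1 i 0 = b i) (hu : ∀ j < n, s.mem 2 j 0 = u j)
    (hs : ∀ a, 3 ≤ a → ∀ i j, s.mem a i j = 0)
    (hG : SafeInput G (homogenize A b u n) u m n) :
    Wp G feasibilityProg (timeBound m n)
      (fun s' => ∃ y, HoldsPoint (projMul (homogenize A b u n) m n y) u n s' ∨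
        HoldsCertificate (projMul (homogenize A b u n) m n y) u y m n s') s := by
  set M := homogenize A b u n with hM
  refine Wp.mono (T := timeBound m n - 8 + 2 + 2 + 2 + 2) (Wp.indSet_seq (Wp.indInc_seq
    (Wp.indSet_seq (Wp.load_seq (by simpa using hG.nat 1 (by omega)) ?_)))) (le_of_eq ?_)
    (fun _ _ h => h)
  swap
  · unfold timeBound; omega
  set s0 : State := _
  show Wp G _ _ _ s0
  have a0 : s0.ind 0 = m := by simp [s0, h0]
  have a1 : s0.ind 1 = n := by simp [s0, h1]
  have a2 : s0.ind 2 = n + 1 := by simp [s0, h1]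
  have a3 : s0.ind 3 = n + 1 := by simp [s0, h1]
  have am : ∀ a, a ≠ 12 → s0.mem a = s.mem a := fun a ha => by
    ext i j; simp [s0, ha]
  have a12 : s0.mem 12 0 0 = 1 := by simp [s0]
  clear_value s0
  rw [timeBound, Nat.add_sub_cancel]
  refine Wp.seq_frame (wp_rowsProg a0 a1 (by rw [am 13 (by simp), hs 13 (by simp)])
    (fun i hi j hj => ?_) (fun i hi => ?_)) fun s1 f1 Q1 => ?_
  · rw [am 0 (by simp), am 2 (by simp), hA i hi j hj, hu j hj]
    simpa [hM, homogenize, hj] using hG.entry i hi j hj.le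
  · rw [am 1 (by simp), hb i hi]
    simpa [hM, homogenize] using hG.entry i hi n le_rfl
  have Q1' : ∀ i < m, ∀ j < n + 1, s1.mem 3 i j = M i j := by
    intro i hi j hj
    rcases Nat.lt_succ_iff_lt_or_eq.1 hj with hj | rfl
    · rw [(Q1.2 i hi).1 j hj, am 0 (by simp), am 2 (by simp), hA i hi j hj, hu j hj]
      simp [hM, homogenize, hj]
    · rw [(Q1.2 i hi).2, am 1 (by simp), hb i hi]
      simp [hM, homogenize]
  have c1 : ∀ a, a ≠ 3 → s1.mem a = s0.mem a := fun a ha => f1.mem a (by simp [rowsProg, ha])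
  refine Wp.seq_frame (wp_initProg (N := n + 1)
    (by rw [f1.ind 2 (by simp [rowsProg]), a2])
    (by rw [c1 4 (by simp), am 4 (by simp)]; exact hs 4 (by simp))
    (by rw [c1 12 (by simp), a12])
    (by rw [c1 14 (by simp), am 14 (by simp), hs 14 (by simp)]) (by simp)
    (fun k hk => hG.nat k (hk.trans (Nat.le_succ _)))) fun s2 f2 Q2 => ?_
  have c2 : ∀ a, a ≠ 4 → a ≠ 10 → a ≠ 14 → s2.mem a = s1.mem a := fun a h h' h'' =>
    f2.mem a (by simp [initProg, h, h', h''])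
  have r2 : ∀ q, q ≠ 3 → q ≠ 4 → q ≠ 6 → s2.ind q = s0.ind q := fun q h h' h'' => by
    rw [f2.ind q (by simp [initProg, h'']), f1.ind q (by simp [rowsProg, h, h', h''])]
  have r23 : s2.ind 3 = n + 1 + m := by
    rw [f2.ind 3 (by simp [initProg]), Q1.1, a3]
  have c12 : s2.mem 12 0 0 = 1 := by
    rw [c2 12 (by simp) (by simp) (by simp), c1 12 (by simp), a12]
  refine Wp.seq_frame (wp_elimProg (M := M) (m := m) (N := n + 1)
    (by rw [r2 0 (by simp) (by simp) (by simp), a0])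
    (by rw [r2 2 (by simp) (by simp) (by simp), a2]) r23 c12
    (by rw [c2 3 (by simp) (by simp) (by simp)]; exact Q1')
    (fun k hk j hj => by rw [Q2.2 k j hj]; rfl) hG.elim) fun s3 f3 Q3 => ?_
  have k3 : ∀ a, a ≠ 4 → a ≠ 5 → a ≠ 6 → a ≠ 7 → s3.mem a = s2.mem a := fun a h h' h'' h''' =>
    f3.mem a (by simp [elimProg, pivotColProg, pivotNormProg, rankOneProg, h, h', h'', h'''])
  have r3 : ∀ q, q ≠ 4 → q ≠ 5 → q ≠ 6 → q ≠ 7 → s3.ind q = s2.ind q := fun q h h' h'' h''' =>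
    f3.ind q (by simp [elimProg, pivotColProg, pivotNormProg, rankOneProg, h, h', h'', h'''])
  have z3 : ∀ a, a = 8 ∨ a = 9 ∨ a = 11 ∨ a = 13 → ∀ i j, s3.mem a i j = 0 := by
    intro a ha i j
    rw [k3 a (by omega) (by omega) (by omega) (by omega),
      c2 a (by omega) (by omega) (by omega), c1 a (by omega), am a (by omega), hs a (by omega)]
  have m12 : s3.mem 12 0 0 = 1 := by
    rw [k3 12 (by simp) (by simp) (by simp) (by simp), c12]
  have r32 : s3.ind 2 = n + 1 := by
    rw [r3 2 (by simp) (by simp) (by simp) (by simp), r2 2 (by simp) (by simp) (by simp), a2]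
  refine Wp.seq_frame (wp_perceptronProg (K := rounds n)
    (isProjTable_projTable M (n + 1) m) (Nat.le_add_right _ m) r32
    (by rw [r3 3 (by simp) (by simp) (by simp) (by simp), r23])
    (by rw [k3 10 (by simp) (by simp) (by simp) (by simp), Q2.1]; rfl) m12
    (z3 13 (by simp) 0 0) (z3 11 (by simp) 0 0) (fun j => z3 8 (by simp) j 0)
    (fun j => z3 9 (by simp) j 0) Q3 (fun k hk => hG.nat k (hk.trans (Nat.le_succ _)))
    hG.product) fun s4 f4 Q4 => ?_
  obtain ⟨y, hy⟩ := Q4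
  have k4 : ∀ a, a ≠ 8 → a ≠ 9 → a ≠ 11 → s4.mem a = s3.mem a := fun a h h' h'' =>
    f4.mem a (by simp [perceptronProg, roundProg, scanProg, updateProg, h, h', h''])
  have r4 : ∀ q, q ≠ 5 → q ≠ 6 → q ≠ 7 → s4.ind q = s3.ind q := fun q h h' h'' =>
    f4.ind q (by simp [perceptronProg, roundProg, scanProg, updateProg, h, h', h''])
  refine (wp_outputProg (M := M) (u := u) (y := y) ?_ ?_ ?_ ?_ ?_ ?_ hy hG).mono le_rfl
    fun s' _ h => ⟨y, h⟩
  · rw [r4 0 (by simp) (by simp) (by simp), r3 0 (by simp) (by simp) (by simp) (by simp),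
      r2 0 (by simp) (by simp) (by simp), a0]
  · rw [r4 1 (by simp) (by simp) (by simp), r3 1 (by simp) (by simp) (by simp) (by simp),
      r2 1 (by simp) (by simp) (by simp), a1]
  · rw [r4 2 (by simp) (by simp) (by simp), r32]
  · rw [k4 12 (by simp) (by simp) (by simp), m12]
  · rw [k4 13 (by simp) (by simp) (by simp), z3 13 (by simp)]
  · rw [k4 2 (by simp) (by simp) (by simp), k3 2 (by simp) (by simp) (by simp) (by simp),
      c2 2 (by simp) (by simp) (by simp), c1 2 (by simp), am 2 (by simp)]
    exact hu

theorem timeBound_le {m n : ℕ} (hmn : m ≤ n) (hn : 0 < n) : timeBound m n ≤ 10000 * n ^ 4 := by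
  have hp : ∀ {a b : ℕ}, a ≤ b → n ^ a ≤ n ^ b := fun h => Nat.pow_le_pow_right hn h
  have hN : n + 1 ≤ 2 * n := by omega
  have h : timeBound m n ≤ ((n * (n * 4 + 10) + 3) + (((2 * n) * 6 + 11) +
      ((n * ((2 * n + n) * ((2 * n) * 14 + 14) + (2 * n) * 6 + 20) + 5) +
      ((16 * (2 * n) ^ 3 * ((2 * n) * 5 + (2 * n + n) * 4 + 15) + 1) + (n * 6 + n * 11 + 25) + 1)
      + 1) + 1) + 1) + 8 := by
    unfold timeBound rounds
    gcongr
  refine h.trans ?_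
  ring_nf
  linarith [hp (show 0 ≤ 4 by norm_num), hp (show 1 ≤ 4 by norm_num), hp (show 2 ≤ 4 by norm_num),
    hp (show 3 ≤ 4 by norm_num)]

/-! ### Sizes of all numbers in the computation -/

theorem rounds_succ_le {n X : ℕ} (hX : n + 1 ≤ X) : rounds n + 1 ≤ 2 ^ (8 * X) := by
  have h1 : (n + 1) ^ 3 ≤ (2 ^ X) ^ 3 := Nat.pow_le_pow_left (hX.trans Nat.lt_two_pow_self.le) 3
  have h2 : 1 ≤ (n + 1) ^ 3 := Nat.one_le_pow _ _ (by omega)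
  calc rounds n + 1 ≤ 2 ^ 5 * (n + 1) ^ 3 := by unfold rounds; omega
    _ ≤ 2 ^ 5 * (2 ^ X) ^ 3 := Nat.mul_le_mul_left _ h1
    _ = 2 ^ (5 + 3 * X) := by rw [← pow_mul, ← pow_add, mul_comm X]
    _ ≤ _ := Nat.pow_le_pow_right (by norm_num) (by omega)

/-- Every intermediate number is a short expression in table entries, which are already bounded
uniformly in `i`. The exponent `9` comes from the squared norm: a sum of at most `X` products of
pivot entries of size `O(X ^ 8)`. -/
theorem safeElim_hasSize {M : ℕ → ℕ → ℝ} {m N X : ℕ} (hX : 1 ≤ X) (hN : N ≤ X) (hm : m ≤ X)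
    (hsize : ∀ k < m, ∀ j < N, HasSize (2 * X) (M k j))
    (hM : ∀ c : Fin m → ℝ, (∀ j < N, ∑ k, c k * M k j = 0) → c = 0) :
    SafeElim (HasSize (200 * X ^ 9)) M N m := by
  have hp : ∀ {a b : ℕ}, a ≤ b → X ^ a ≤ X ^ b := fun h => Nat.pow_le_pow_right hX h
  have h0 := Nat.zero_le (X ^ 8)
  have h19 := hp (show 1 ≤ 9 by norm_num)
  have h18 := hp (show 1 ≤ 8 by norm_num)
  have h28 := hp (show 2 ≤ 8 by norm_num)
  have h08 := hp (show 0 ≤ 8 by norm_num)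
  have h79 := hp (show 7 ≤ 9 by norm_num)
  have h89 := hp (show 8 ≤ 9 by norm_num)
  have hS : ∀ i ≤ m, ∀ k < N + m, ∀ j < N, HasSize (40 * X ^ 7) (projTable M N i k j) :=
    fun i hi k hk j hj => hasSize_projTable hX hN hm hsize hM hi hk hj
  have hmul : ∀ i < m, ∀ k < N + m, ∀ j < N,
      HasSize (40 * X ^ 7 + 2 * X) (projTable M N i k j * M i j) :=
    fun i hi k hk j hj => (hS i hi.le k hk j hj).mul (hsize i hi j hj)
  have hpart : ∀ i < m, ∀ k < N + m, ∀ l ≤ N,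
      HasSize (43 * X ^ 8) (∑ j ∈ range l, projTable M N i k j * M i j) :=
    fun i hi k hk l hl => (HasSize.sum (k := X) (by simpa using hl.trans hN) fun j hj =>
      hmul i hi k hk j ((mem_range.1 hj).trans_le hl)).mono (by linarith)
  have hcol : ∀ i < m, ∀ k < N + m, HasSize (44 * X ^ 8) (pivotCol M N (projTable M N i) i k) := by
    intro i hi k hk
    have h3 : HasSize 0 (if k = N + i then (1 : ℝ) else 0) := by
      split_ifs
      exacts [hasSize_one _, hasSize_zero _]
    exact ((hpart i hi k hk N le_rfl).add h3).mono (by linarith)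
  have hcolMul : ∀ i < m, ∀ k < N + m, ∀ j < N + m, HasSize (88 * X ^ 8)
      (pivotCol M N (projTable M N i) i k * pivotCol M N (projTable M N i) i j) :=
    fun i hi k hk j hj => ((hcol i hi k hk).mul (hcol i hi j hj)).mono (by linarith)
  have hnorm : ∀ i < m, ∀ l ≤ N, HasSize (89 * X ^ 9) (∑ j ∈ range l,
      pivotCol M N (projTable M N i) i j * pivotCol M N (projTable M N i) i j) :=
    fun i hi l hl => (HasSize.sum (k := X) (by simpa using hl.trans hN) fun j hj => by
      have := mem_range.1 hj
      exact hcolMul i hi j (by omega) j (by omega)).mono (by linarith)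
  exact
    { zero := hasSize_zero _
      mul := fun i hi k hk j hj => (hmul i hi k hk j hj).mono (by linarith)
      partialCol := fun i hi k hk l hl => (hpart i hi k hk l hl).mono (by linarith)
      col := fun i hi k hk => (hcol i hi k hk).mono (by linarith)
      colMul := fun i hi k hk j hj => (hcolMul i hi k hk j (by omega)).mono (by linarith)
      partialNorm := fun i hi l hl => (hnorm i hi l hl).mono (by linarith)
      div := fun i hi k hk j hj =>
        ((hcolMul i hi k hk j (by omega)).div (hnorm i hi N le_rfl)).mono (by linarith)
      table := fun i hi k hk j hj => (hS i hi k hk j hj).mono (by linarith) }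

theorem safeInput_hasSize {M : ℕ → ℕ → ℝ} {u : ℕ → ℝ} {m n X : ℕ} (hN : n + 1 ≤ X)
    (hm : m ≤ X) (hsize : ∀ k < m, ∀ j < n + 1, HasSize (2 * X) (M k j))
    (hu : ∀ j < n, HasSize X (u j))
    (hM : ∀ c : Fin m → ℝ, (∀ j < n + 1, ∑ k, c k * M k j = 0) → c = 0) :
    SafeInput (HasSize (200 * X ^ 9)) M u m n := by
  have hX : 1 ≤ X := by omega
  have hp : ∀ {a b : ℕ}, a ≤ b → X ^ a ≤ X ^ b := fun h => Nat.pow_le_pow_right hX h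
  have h0 := Nat.zero_le (X ^ 8)
  have h19 := hp (show 1 ≤ 9 by norm_num)
  have h18 := hp (show 1 ≤ 8 by norm_num)
  have h28 := hp (show 2 ≤ 8 by norm_num)
  have h89 := hp (show 8 ≤ 9 by norm_num)
  have hnat : ∀ k ≤ rounds n + 1, HasSize (8 * X) (k : ℕ) :=
    fun k hk => hasSize_nat (hk.trans (rounds_succ_le hN))
  have hprod : ∀ y : ℕ → ℕ, ∑ j ∈ range (n + 1), y j ≤ rounds n →
      ∀ k < n + 1 + m, HasSize (49 * X ^ 8) (projMul M m n y k) := by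
    intro y hy k hk
    rw [projMul, tableMul]
    refine (HasSize.sum (e := 40 * X ^ 7 + 8 * X) (k := X) (by simpa using hN)
      fun j hj => ?_).mono (by linarith)
    have hj := mem_range.1 hj
    exact (hasSize_projTable hX hN hm hsize hM le_rfl hk hj).mul
      (hnat _ ((le_of_sum_le hy hj).trans (Nat.le_succ _)))
  exact
    { elim := safeElim_hasSize hX hN hm hsize hM
      entry := fun i hi j hj => (hsize i hi j (by omega)).mono (by linarith)
      nat := fun k hk => (hnat k hk).mono (by linarith)
      product := fun y hy k hk => (hprod y hy k hk).mono (by linarith)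
      ratio := fun y hy j hj =>
        ((hprod y hy j (by omega)).div (hprod y hy n (by omega))).mono (by linarith)
      point := fun y hy j hj =>
        (((hprod y hy j (by omega)).div (hprod y hy n (by omega))).mul (hu j hj)).mono
          (by linarith)
      weight := fun k hk j hj => ((hnat k hk).div (hu j hj)).mono (by linarith) }

theorem safeInput_true (M : ℕ → ℕ → ℝ) (u : ℕ → ℝ) (m n : ℕ) :
    SafeInput (fun _ => True) M u m n := by
  constructor <;> first | (constructor <;> intros <;> trivial) | (intros; trivial)

end LPFeas

namespace LPFeas
open RealRAM

/-! ### Correctness of the two outputs -/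

/-- Scaling columns by positive factors preserves independence of the rows, so the columns coming
from `A` already suffice. -/
theorem homogenize_row_independent {m n : ℕ} {A : Matrix (Fin m) (Fin n) ℝ} (hA : A.rank = m)
    {A' : ℕ → ℕ → ℝ} {b' u' : ℕ → ℝ} (hA' : ∀ (i : Fin m) (j : Fin n), A' i j = A i j)
    (hu : ∀ j < n, 0 < u' j) (c : Fin m → ℝ)
    (hc : ∀ j < n + 1, ∑ k, c k * homogenize A' b' u' n k j = 0) : c = 0 := by
  have hli : LinearIndependent ℝ A.row := by
    rw [linearIndependent_iff_card_eq_finrank_span, Fintype.card_fin]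
    exact hA.symm.trans A.rank_eq_finrank_span_row
  rw [Fintype.linearIndependent_iff] at hli
  refine funext (hli c (funext fun j => ?_))
  have h := hc j (by omega)
  have h1 : (∑ k, c k * A k j) * u' j = 0 := by
    rw [← h, sum_mul]
    refine sum_congr rfl fun k _ => ?_
    rw [homogenize, if_pos j.2, hA']
    ring
  have h2 := (mul_eq_zero.1 h1).resolve_right (hu j j.2).ne'
  simpa [Finset.sum_apply] using h2

theorem sum_homogenize {m n : ℕ} {A : Matrix (Fin m) (Fin n) ℝ} {A' : ℕ → ℕ → ℝ} {b' u' : ℕ → ℝ}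
    (hA' : ∀ (i : Fin m) (j : Fin n), A' i j = A i j) (i : Fin m) (z : ℕ → ℝ) :
    ∑ j ∈ range (n + 1), homogenize A' b' u' n i j * z j =
      ∑ j : Fin n, A i j * (u' j * z j) - b' i * z n := by
  rw [sum_range_succ, ← Fin.sum_univ_eq_sum_range (fun j => homogenize A' b' u' n i j * z j)]
  simp only [homogenize, Fin.is_lt, if_true, hA', lt_irrefl, if_false]
  rw [neg_mul, ← sub_eq_add_neg]
  congr 1
  exact sum_congr rfl fun j _ => by ring

theorem HoldsPoint.correct {m n : ℕ} {A : Matrix (Fin m) (Fin n) ℤ} {b : Fin m → ℤ}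
    {u : Fin n → ℝ} {A' : ℕ → ℕ → ℝ} {b' u' : ℕ → ℝ} {y : ℕ → ℕ} {s : State}
    (hA : ∀ (i : Fin m) (j : Fin n), A' i j = A.map (Int.cast : ℤ → ℝ) i j)
    (hb : ∀ i : Fin m, b' i = b i) (hu : ∀ j < n, 0 < u' j)
    (h : HoldsPoint (projMul (homogenize A' b' u' n) m n y) u' n s) :
    (readOutput m n s).Correct A b u := by
  obtain ⟨h0, hpos, hx⟩ := h
  set z := projMul (homogenize A' b' u' n) m n y with hz
  rw [readOutput, if_pos h0]
  have hzn := hpos n (by omega)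
  refine ⟨funext fun i => ?_, fun j => ?_⟩
  · have h1 := (isProjTable_projTable (homogenize A' b' u' n) (n + 1) m).sum_mul_tableMul y i.2
    change ∑ j ∈ range (n + 1), homogenize A' b' u' n i j * z j = 0 at h1
    rw [sum_homogenize hA, hb] at h1
    rw [Matrix.mulVec, dotProduct]
    have h2 : ∑ j : Fin n, A.map (Int.cast : ℤ → ℝ) i j * s.mem 0 j 0 =
        (∑ j : Fin n, A.map (Int.cast : ℤ → ℝ) i j * (u' j * z j)) / z n := by
      rw [sum_div]
      refine sum_congr rfl fun j _ => ?_
      rw [hx j j.2]; ring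
    rw [h2, div_eq_iff hzn.ne']
    linarith
  · change 0 ≤ s.mem 0 j 0
    rw [hx j j.2]
    exact mul_nonneg (div_nonneg (hpos j (by omega)).le hzn.le) (hu j j.2).le

/-- In the scaled variable `x j / u j`, which lies in `[0, 1]`, the left side has coefficients `z j
+ δ j`: adding `w` cancels the `-y` in `Mᵀ v = z - y`. The last column of the same identity gives
`vᵀ b = y n - z n`. -/
theorem HoldsCertificate.correct {m n : ℕ} {A : Matrix (Fin m) (Fin n) ℤ} {b : Fin m → ℤ}
    {u : Fin n → ℝ} {A' : ℕ → ℕ → ℝ} {b' u' : ℕ → ℝ} {y : ℕ → ℕ} {s : State} (hn : 0 < n)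
    (hA : ∀ (i : Fin m) (j : Fin n), A' i j = A.map (Int.cast : ℤ → ℝ) i j)
    (hb : ∀ i : Fin m, b' i = b i) (hu : ∀ j : Fin n, u' j = u j) (hu0 : ∀ j, 0 < u j)
    (h : HoldsCertificate (projMul (homogenize A' b' u' n) m n y) u' y m n s) :
    (readOutput m n s).Correct A b u := by
  obtain ⟨h0, hsum, hsq, hv, hw⟩ := h
  set z := projMul (homogenize A' b' u' n) m n y with hz
  set δ : ℕ → ℝ := fun j => if j = 0 then 1 else 0 with hδ
  have hδ0 : ∀ j, 0 ≤ δ j := fun j => by simp only [hδ]; split_ifs <;> norm_num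
  rw [readOutput, if_neg (by rw [h0]; norm_num)]
  set v : Fin m → ℝ := fun i => s.mem 0 i 0 with hvdef
  set w : Fin n → ℝ := fun j => s.mem 1 j 0 with hwdef
  have hw' : ∀ j : Fin n, w j * u j = y j + δ j := by
    intro j
    simp only [hwdef]
    rw [hw j j.2, hu, div_mul_cancel₀ _ (hu0 j).ne']
    simp [hδ]
  have hδsum : ∑ j : Fin n, δ j = 1 := by
    rw [Fin.sum_univ_eq_sum_range δ n]
    simp [hδ, hn.ne']
  have hcol : ∀ j < n + 1, ∑ i : Fin m, homogenize A' b' u' n i j * v i = z j - y j := by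
    intro j hj
    have h1 := (isProjTable_projTable (homogenize A' b' u' n) (n + 1) m).sum_mul_tableMul_add y hj
    rw [← Fin.sum_univ_eq_sum_range (fun k => homogenize A' b' u' n k j *
      tableMul (projTable (homogenize A' b' u' n) (n + 1) m) (n + 1) y (n + 1 + k))] at h1
    refine Eq.trans (sum_congr rfl fun i _ => ?_) h1
    simp only [hvdef]
    rw [hv i i.2]
    rfl
  have hvb : v ⬝ᵥ (fun i => (b i : ℝ)) = y n - z n := by
    have h1 := hcol n (by omega)
    simp only [homogenize, lt_irrefl, if_false, hb, neg_mul, sum_neg_distrib] at h1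
    rw [dotProduct]
    simp_rw [mul_comm (v _)]
    linarith
  have hvA : ∀ j : Fin n, (v ᵥ* A.map (Int.cast : ℤ → ℝ)) j * u j = z j - y j := by
    intro j
    rw [← hcol j (by omega), Matrix.vecMul, dotProduct, sum_mul]
    refine sum_congr rfl fun i _ => ?_
    rw [homogenize, if_pos j.2, hA, hu]
    ring
  have hwu : w ⬝ᵥ u = ∑ j : Fin n, (y j : ℝ) + 1 := by
    rw [dotProduct, sum_congr rfl fun j _ => hw' j, sum_add_distrib, hδsum]
  have hnR : (0 : ℝ) < n := by exact_mod_cast hn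
  refine ⟨fun j => ?_, fun h => ?_, fun x hx0 hxu => ?_⟩
  · refine le_of_mul_le_mul_right ?_ (hu0 j)
    rw [hw' j]
    simpa using add_nonneg (Nat.cast_nonneg (y j)) (hδ0 j)
  · have h1 := hwu
    rw [h, zero_dotProduct] at h1
    have : (0 : ℝ) ≤ ∑ j : Fin n, (y j : ℝ) := sum_nonneg fun _ _ => Nat.cast_nonneg _
    linarith
  · have hle : (v ᵥ* A.map (Int.cast : ℤ → ℝ) + w) ⬝ᵥ x ≤ ∑ j : Fin n, max (z j) 0 + 1 := by
      rw [dotProduct, ← hδsum, ← sum_add_distrib]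
      refine sum_le_sum fun j _ => ?_
      have h1 : (v ᵥ* A.map (Int.cast : ℤ → ℝ) + w) j * x j = (z j + δ j) * (x j / u j) := by
        rw [Pi.add_apply]
        have h2 := hvA j
        have h3 := hw' j
        have h4 : (v ᵥ* A.map (Int.cast : ℤ → ℝ)) j * u j + w j * u j = z j + δ j := by linarith
        rw [← h4]
        have := (hu0 j).ne'
        field_simp
      have h5 : 0 ≤ x j / u j := div_nonneg (hx0 j) (hu0 j).le
      have h6 : x j / u j ≤ 1 := (div_le_one (hu0 j)).2 (hxu j)
      rw [h1]
      have h7 : 0 ≤ max (z j) 0 + δ j := add_nonneg (le_max_right _ _) (hδ0 j)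
      calc (z j + δ j) * (x j / u j) ≤ (max (z j) 0 + δ j) * (x j / u j) := by
            gcongr; exact le_max_left _ _
        _ ≤ (max (z j) 0 + δ j) * 1 := mul_le_mul_of_nonneg_left h6 h7
        _ = _ := mul_one _
    have hmax : ∑ j ∈ range (n + 1), max (z j) 0 ≤ 4 * ((n : ℝ) + 1) ^ 2 := by
      refine sum_max_le_of_sum_sq_le (by positivity) ?_
      have : (rounds n : ℝ) = 16 * ((n : ℝ) + 1) ^ 3 := by rw [rounds]; push_cast; ring
      rw [this] at hsq
      calc ((n + 1 : ℕ) : ℝ) * ∑ j ∈ range (n + 1), z j ^ 2 ≤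
          ((n + 1 : ℕ) : ℝ) * (16 * ((n : ℝ) + 1) ^ 3) := by gcongr
        _ = _ := by push_cast; ring
    rw [sum_range_succ, ← Fin.sum_univ_eq_sum_range (fun j => max (z j) 0) n] at hmax
    have hsum' : ∑ j : Fin n, (y j : ℝ) + y n = 16 * ((n : ℝ) + 1) ^ 3 := by
      rw [sum_range_succ, ← Fin.sum_univ_eq_sum_range y n] at hsum
      have : ((∑ j : Fin n, y j + y n : ℕ) : ℝ) = (rounds n : ℕ) := by rw [hsum]
      rw [rounds] at this
      push_cast at this
      exact this
    rw [hvb, hwu]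
    refine hle.trans_lt ?_
    have hn1 : (1 : ℝ) ≤ n := by exact_mod_cast hn
    have hzn := le_max_left (z n) 0
    -- The last coordinate enters through `vᵀ b` with weight `1`, at least the `1 / (2 n)` of the
    -- others, so the right side collects at least `K / (2 n) - z n`.
    have hyn : (y n : ℝ) * (1 / (2 * n)) ≤ y n :=
      mul_le_of_le_one_right (Nat.cast_nonneg _) (by
        rw [div_le_one (by positivity)]; linarith)
    -- The constant `16` leaves twice the Cauchy-Schwarz bound `4 (n + 1) ^ 2`, enough to absorb the
    -- `1` coming from `δ`.
    have hkey : 8 * ((n : ℝ) + 1) ^ 2 ≤ 1 / (2 * n) * (16 * ((n : ℝ) + 1) ^ 3) := by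
      rw [div_mul_eq_mul_div, le_div_iff₀ (by positivity)]
      nlinarith [sq_nonneg ((n : ℝ) + 1)]
    have hpos : 0 < 1 / (2 * (n : ℝ)) := by positivity
    rw [← hsum'] at hkey
    nlinarith

theorem Wp.run {G : ℝ → Prop} {p : Prog} {T : ℕ} {Q : State → Prop} {s : State}
    (h : Wp G p T Q s) (hs : s.Good G) : ∃ t ≤ T, (p.run s t).todo = [] ∧ Q (p.run s t).state ∧
      ∀ k ≤ t, (p.run s k).state.Good G := by
  obtain ⟨t, ht, s', hr, hq⟩ := h hs
  have h1 := hr []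
  refine ⟨t, ht, ?_, ?_, fun k hk => h1.2 k hk⟩
  · rw [Prog.run, h1.1]
  · rw [Prog.run, h1.1]; exact hq

theorem inputState_good {G : ℝ → Prop} {m n : ℕ} {A : Matrix (Fin m) (Fin n) ℤ} {b : Fin m → ℤ}
    {u : Fin n → ℝ} (h0 : G 0) (hA : ∀ i j, G (A i j)) (hb : ∀ i, G (b i)) (hu : ∀ j, G (u j)) :
    (inputState A b u).Good G := by
  intro a i j
  simp only [inputState]
  split_ifs <;> first | exact hA _ _ | exact hb _ | exact hu _ | exact h0

/-- The algorithm is correct on every instance on which its numbers are good. -/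
theorem feasibilityProg_correct {G : ℝ → Prop} {m n : ℕ} {A : Matrix (Fin m) (Fin n) ℤ}
    {b : Fin m → ℤ} {u : Fin n → ℝ} (hn : 0 < n) (hmn : m ≤ n) (hu : ∀ j, 0 < u j)
    (hgood : (inputState A b u).Good G)
    (hG : SafeInput G (homogenize ((inputState A b u).mem 0)
      (fun i => (inputState A b u).mem 1 i 0) (fun j => (inputState A b u).mem 2 j 0) n)
      (fun j => (inputState A b u).mem 2 j 0) m n) :
    ∃ t ≤ 10000 * n ^ 4, (feasibilityProg.run (inputState A b u) t).todo = [] ∧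
      (readOutput m n (feasibilityProg.run (inputState A b u) t).state).Correct A b u ∧
      ∀ k ≤ t, (feasibilityProg.run (inputState A b u) k).state.Good G := by
  have hw := wp_feasibilityProg (G := G) (m := m) (n := n) (s := inputState A b u)
    (by simp [inputState]) (by simp [inputState]) (fun _ _ _ _ => rfl) (fun _ _ => rfl)
    (fun _ _ => rfl)
    (fun a ha i j => by
      simp [inputState, show a ≠ 0 by omega, show a ≠ 1 by omega, show a ≠ 2 by omega]) hG
  obtain ⟨t, ht, htodo, ⟨y, hQ⟩, hk⟩ := Wp.run hw hgood
  refine ⟨t, ht.trans (timeBound_le hmn hn), htodo, ?_, hk⟩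
  have hA' : ∀ (i : Fin m) (j : Fin n),
      (inputState A b u).mem 0 i j = A.map (Int.cast : ℤ → ℝ) i j := fun i j => by
    simp [inputState]
  have hb' : ∀ i : Fin m, (inputState A b u).mem 1 i 0 = b i := fun i => by simp [inputState]
  have hu' : ∀ j : Fin n, (inputState A b u).mem 2 j 0 = u j := fun j => by simp [inputState]
  rcases hQ with h | h
  · exact h.correct hA' hb' fun j hj => by rw [hu' ⟨j, hj⟩]; exact hu _
  · exact h.correct hn hA' hb' hu' hu

theorem le_inputSize {m n : ℕ} (A : Matrix (Fin m) (Fin n) ℤ) (b : Fin m → ℤ) (u : Fin n → ℚ) :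
    n ≤ inputSize A b u ∧ (∀ i j, ratSize (A i j : ℚ) ≤ inputSize A b u) ∧
      (∀ i, ratSize (b i : ℚ) ≤ inputSize A b u) ∧ ∀ j, ratSize (u j) ≤ inputSize A b u := by
  unfold inputSize
  refine ⟨?_, fun i j => ?_, fun i => ?_, fun j => ?_⟩
  · have : ∑ _j : Fin n, 1 ≤ ∑ j, ratSize (u j) :=
      sum_le_sum fun j _ => by unfold ratSize; omega
    rw [sum_const, card_univ, Fintype.card_fin, smul_eq_mul, mul_one] at this
    omega
  · have h1 := single_le_sum (f := fun j => ratSize (A i j : ℚ)) (fun _ _ => Nat.zero_le _)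
      (mem_univ j)
    have h2 := single_le_sum (f := fun i => ∑ j, ratSize (A i j : ℚ)) (fun _ _ => Nat.zero_le _)
      (mem_univ i)
    omega
  · have h1 := single_le_sum (f := fun i => ratSize (b i : ℚ)) (fun _ _ => Nat.zero_le _)
      (mem_univ i)
    omega
  · have h1 := single_le_sum (f := fun j => ratSize (u j)) (fun _ _ => Nat.zero_le _) (mem_univ j)
    omega

end LPFeas

/-! ### The main theorem -/

open RealRAM LPFeas in
theorem theorem1 :
    ∃ (alg : Prog) (C c d : ℕ),
      ∀ (m n : ℕ) (A : Matrix (Fin m) (Fin n) ℤ) (b : Fin m → ℤ) (u : Fin n → ℝ),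
        0 < n → (A.map (Int.cast : ℤ → ℝ)).rank = m → (∀ j, 0 < u j) →
        ∃ t : ℕ, t ≤ C * n ^ 4 ∧
          (alg.run (inputState A b u) t).todo = [] ∧
          (readOutput m n (alg.run (inputState A b u) t).state).Correct A b u ∧
          ∀ u' : Fin n → ℚ, (∀ j, u j = (u' j : ℝ)) →
            ∀ k ≤ t, ∀ a i j : ℕ, ∃ q : ℚ,
              (alg.run (inputState A b u) k).state.mem a i j = (q : ℝ) ∧
              ratSize q ≤ c * inputSize A b u' ^ d := by
  -- `206336 = (2 * 200 + 3) * 2 ^ 9`: fractions of size `200 * X ^ 9` with `X = 2 * N` have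
  -- encoding size at most `2 * (200 * X ^ 9) + 3`.
  refine ⟨feasibilityProg, 10000, 206336, 9, fun m n A b u hn hA hu => ?_⟩
  have hmn : m ≤ n := by
    rw [← hA]
    simpa using Matrix.rank_le_width (A.map (Int.cast : ℤ → ℝ))
  -- The program is the same in both cases. For irrational `u` the size claim is vacuous and the
  -- trivial predicate is used.
  by_cases hrat : ∃ u' : Fin n → ℚ, ∀ j, u j = (u' j : ℝ)
  · obtain ⟨u', hu'⟩ := hrat
    obtain ⟨hnN, hAN, hbN, huN⟩ := le_inputSize A b u'
    set N := inputSize A b u' with hN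
    have hgood : (inputState A b u).Good (HasSize N) := by
      refine inputState_good (hasSize_zero _) (fun i j => ?_) (fun i => ?_) fun j => ?_
      · simpa using hasSize_of_ratSize_le (hAN i j)
      · simpa using hasSize_of_ratSize_le (hbN i)
      · rw [hu' j]; exact hasSize_of_ratSize_le (huN j)
    have hN1 : N ≤ 200 * (2 * N) ^ 9 := by
      have := Nat.le_self_pow (show 9 ≠ 0 by norm_num) (2 * N)
      omega
    -- The parameter is `2 * N` rather than `N` because it must dominate `n + 1`, while only `n ≤ N`
    -- is available.
    have hsafe := safeInput_hasSize (M := homogenize ((inputState A b u).mem 0)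
      (fun i => (inputState A b u).mem 1 i 0) (fun j => (inputState A b u).mem 2 j 0) n)
      (show n + 1 ≤ 2 * N by omega) (show m ≤ 2 * N by omega)
      (fun k _ j _ => by
        rw [homogenize]
        split_ifs
        · exact ((hgood 0 k j).mul (hgood 2 j 0)).mono (by omega)
        · exact (hgood 1 k 0).neg.mono (by omega))
      (fun j _ => (hgood 2 j 0).mono (by omega))
      (homogenize_row_independent hA (fun i j => by simp [inputState])
        fun j hj => by simpa [inputState, hj] using hu ⟨j, hj⟩)
    obtain ⟨t, ht, htodo, hcorrect, hk⟩ := feasibilityProg_correct hn hmn hu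
      (fun a i j => (hgood a i j).mono hN1) hsafe
    refine ⟨t, ht, htodo, hcorrect, fun u'' hu'' k hkt a i j => ?_⟩
    obtain rfl : u'' = u' := funext fun j => by
      have := (hu'' j).symm.trans (hu' j)
      exact_mod_cast this
    obtain ⟨q, hq, hsize⟩ := (hk k hkt a i j).exists_rat
    refine ⟨q, hq, hsize.trans ?_⟩
    have : 1 ≤ N ^ 9 := Nat.one_le_pow _ _ (by omega)
    rw [mul_pow, ← hN]
    omega
  · obtain ⟨t, ht, htodo, hcorrect, _⟩ := feasibilityProg_correct (G := fun _ => True)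
      (A := A) (b := b) (u := u) hn hmn hu (fun _ _ _ => trivial) (safeInput_true _ _ _ _)
    exact ⟨t, ht, htodo, hcorrect, fun u' hu' => absurd ⟨u', hu'⟩ hrat⟩
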